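/- **Setting.** A $k$-variable Boolean function is a map $f:\{0,1\}^k\to\{0,1\}$. A $k$-variable and/or tree is a finite rooted tree in which every internal node has at least two children and is labelled by $\land$ or $\lor$, and every leaf is labelled by a literal from $\{x_1,\bar x_1,\dots,x_k,\bar x_k\}$; it represents a Boolean function in the obvious way, and its size is its number of leaves. The complexity $L(f)$ of a non-constant $f$ is the smallest size of an and/or tree representing $f$; $L(f)=0$ for the two constant functions. The variable $x_i$ is essential for $f$ if the restrictions of $f$ to $x_i=0$ and $x_i=1$ differ, and $\mathrm{Ess}(f)$ is the number of essential variables. A function $f$ is read-once if it is represented by an and/or tree in which each variable labels at most one leaf (as $x_i$ or $\bar x_i$). Let $\xi$ be a random variable with values in $\{0,1,2,\dots\}$ such that $\mathbb E[\xi]=1$, $\mathbb P(\xi=1)=0$ and $\mathbb E[e^{a\xi}]<\infty$ for some $a>0$. Let $T_\infty$ be the Galton--Watson tree with offspring distribution $\xi$ conditioned on being infinite: it has an infinite path $u_0,u_1,\dots$ starting at the root $u_0$; the numbers of children of the $u_i$ are i.i.d. with the size-biased law $\mathbb P(\hat\xi=n)=n\,\mathbb P(\xi=n)$; $u_{i+1}$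 is a uniformly chosen child of $u_i$; and all other children of the $u_i$ are roots of independent unconditioned Galton--Watson trees with offspring distribution $\xi$. Given $T_\infty$, label the nodes independently, with connectives uniform in $\{\land,\lor\}$ and literals uniform in $\{x_1,\bar x_1,\dots,x_k,\bar x_k\}$ (connectives are used at internal nodes, literals at leaves, including the nodes that become leaves when the tree is truncated). Let $P_k[T_\infty](f)$ be the probability (over both the tree and the labels) that, for all sufficiently large $h$, the truncation at height $h$ of the labelled tree represents $f$. **Theorem.** There are constants $c_1,c_2>0$, depending only on the law of $\xi$, such that for every $k\ge2$ and every $k$-variable Boolean function $f$, $$P_k[T_\infty](f)\le \exp\Bigl(-c_2\frac{L(f)}{k^2}-\log\binom{k}{\mathrm{Ess}(f)}\Bigr),$$ and, if $f$ is not constant, $$\exp\bigl(-c_1L(f)\log k\bigr)\le P_k[T_\infty](f).$$ Moreover, the upper bound is sharp, at the level of exponents, for read-once functions: for every $\varepsilon>0$ there are constants $c_3,c_4>0$ (depending only on $\varepsilon$ and the law of $\xi$) such that for every $k\ge2$ and every read-once $k$-variable function $f$ with $L(f)\le k^{1-\varepsilon}$, $$P_k[T_\infty](f)\le\exp\bigl(-c_3L(f)\log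 k\bigr)\quad\text{and}\quad \Bigl[\exp\Bigl(-c_2\frac{L(f)}{k^2}-\log\binom{k}{\mathrm{Ess}(f)}\Bigr)\Bigr]^{c_4}\le P_k[T_\infty](f).$$ -/

import Mathlib

open MeasureTheory Filter
open scoped ENNReal

noncomputable section

namespace AndOr

/-- A `k`-variable Boolean function. -/
abbrev BoolFun (k : ℕ) : Type := (Fin k → Bool) → Bool

/-- A `k`-variable and/or tree. A leaf carries a literal: `(i, true)` is the variable `x_i` and
`(i, false)` is its negation. An internal node carries a connective (`true` is the conjunction,
`false` is the disjunction) and has `n + 2` children for some `n`, that is at least two. -/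
inductive BTree (k : ℕ) : Type
  | leaf (l : Fin k × Bool) : BTree k
  | node (c : Bool) (n : ℕ) (ch : Fin (n + 2) → BTree k) : BTree k

/-- The Boolean function represented by an and/or tree. -/
def BTree.eval {k : ℕ} : BTree k → BoolFun k
  | .leaf l => fun x => if l.2 = true then x l.1 else !(x l.1)
  | .node true _ ch => fun x => decide (∀ j, (ch j).eval x = true)
  | .node false _ ch => fun x => decide (∃ j, (ch j).eval x = true)

/-- The size of a tree: its number of leaves. -/
def BTree.size {k : ℕ} : BTree k → ℕ
  | .leaf _ => 1
  | .node _ _ ch => ∑ j, (ch j).size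

/-- The number of leaves labelled by `x_i` or by its negation. -/
def BTree.occ {k : ℕ} (i : Fin k) : BTree k → ℕ
  | .leaf l => if l.1 = i then 1 else 0
  | .node _ _ ch => ∑ j, (ch j).occ i

/-- `f` is one of the two constant functions. -/
def IsConst {k : ℕ} (f : BoolFun k) : Prop := ∃ b : Bool, ∀ x, f x = b

open Classical in
/-- The complexity of `f`: the size of the smallest trees representing it, and `0` for the two
constant functions. -/
def complexity {k : ℕ} (f : BoolFun k) : ℕ :=
  if IsConst f then 0 else sInf {m : ℕ | ∃ τ : BTree k, τ.eval = f ∧ τ.size = m}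

/-- The variable `x_i` is essential for `f`. -/
def IsEssential {k : ℕ} (f : BoolFun k) (i : Fin k) : Prop :=
  ∃ x : Fin k → Bool, f (Function.update x i false) ≠ f (Function.update x i true)

/-- The number of essential variables of `f`. -/
def ess {k : ℕ} (f : BoolFun k) : ℕ := {i : Fin k | IsEssential f i}.ncard

/-- `f` is read-once: it is represented by a tree in which each variable occurs at most once. -/
def ReadOnce {k : ℕ} (f : BoolFun k) : Prop :=
  ∃ τ : BTree k, τ.eval = f ∧ ∀ i, τ.occ i ≤ 1

/-! A (possibly infinite, locally finite) plane tree is given by offspring numbers on the words in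
`List ℕ`: the root is `[]` and the children of `u` are `j :: u` for `j < offspring u`. -/

/-- The truncation at height `h` of the labelled tree rooted at `u`. Every word `u` carries a
connective `(lab u).1`, used if `u` is an internal node of the truncation, and a literal
`(lab u).2`, used if `u` is a leaf of it. In a node with a single child (which has probability
zero for the random trees considered below) the connective acts as the identity. -/
def truncation {k : ℕ} (offspring : List ℕ → ℕ) (lab : List ℕ → Bool × (Fin k × Bool)) :
    ℕ → List ℕ → BTree k
  | 0, u => .leaf (lab u).2
  | h + 1, u =>
    match offspring u with
    | 0 => .leaf (lab u).2
    | 1 => truncation offspring lab h (0 :: u)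
    | n + 2 => .node (lab u).1 n fun j => truncation offspring lab h (j.1 :: u)

/-- The labelled tree represents `f`: its truncations at all large heights do. -/
def Represents {k : ℕ} (offspring : List ℕ → ℕ) (lab : List ℕ → Bool × (Fin k × Bool))
    (f : BoolFun k) : Prop :=
  ∀ᶠ h in atTop, (truncation offspring lab h []).eval = f

/-- The law of the pair formed by the size-biased offspring number `n` (which has probability
`n * p n`) of a node of the spine and by the position `j < n`, uniform given `n`, of its child
on the spine: each pair `(n, j)` with `j < n` has probability `p n`. -/
def sizeBiased (p : PMF ℕ) (hp : ∑' n : ℕ, (n : ℝ≥0∞) * p n = 1) : PMF (ℕ × ℕ) :=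
  ⟨fun q => if q.2 < q.1 then p q.1 else 0, by
    have h : ∑' q : ℕ × ℕ, (if q.2 < q.1 then p q.1 else 0) = 1 := by
      rw [ENNReal.tsum_prod', ← hp]
      refine tsum_congr fun n => ?_
      rw [tsum_eq_sum (s := Finset.range n)]
      · rw [Finset.sum_congr rfl fun j hj => if_pos (Finset.mem_range.1 hj)]
        simp
      · intro j hj
        exact if_neg fun h => hj (Finset.mem_range.2 h)
    exact h ▸ ENNReal.summable.hasSum⟩

/-- The randomness of the critical Galton--Watson tree conditioned on being infinite: i.i.d.
offspring numbers with law `p` for all words (used off the spine), and i.i.d. size-biased pairs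
for the nodes of the spine, independent of the former. -/
def treeMeasure (p : PMF ℕ) (hp : ∑' n : ℕ, (n : ℝ≥0∞) * p n = 1) :
    Measure ((List ℕ → ℕ) × (ℕ → ℕ × ℕ)) :=
  (Measure.infinitePi fun _ : List ℕ => p.toMeasure).prod
    (Measure.infinitePi fun _ : ℕ => (sizeBiased p hp).toMeasure)

/-- The node at height `i` of the spine. -/
def spine (s : ℕ → ℕ × ℕ) : ℕ → List ℕ
  | 0 => []
  | i + 1 => (s i).2 :: spine s i

/-- The offspring numbers of the Galton--Watson tree conditioned on being infinite. -/
def offspring (ω : (List ℕ → ℕ) × (ℕ → ℕ × ℕ)) (u : List ℕ) : ℕ :=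
  if u = spine ω.2 u.length then (ω.2 u.length).1 else ω.1 u

/-- The law of the labels: all connectives and literals are uniform and independent. -/
def labelMeasure (k : ℕ) [NeZero k] : Measure (List ℕ → Bool × (Fin k × Bool)) :=
  Measure.infinitePi fun _ : List ℕ =>
    (PMF.uniformOfFintype (Bool × (Fin k × Bool))).toMeasure

/-- The probability that the randomly `k`-labelled version of the critical Galton--Watson tree
with offspring law `p`, conditioned on being infinite, represents `f`. -/
def prob (p : PMF ℕ) (hp : ∑' n : ℕ, (n : ℝ≥0∞) * p n = 1) (k : ℕ) [NeZero k]
    (f : BoolFun k) : ℝ :=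
  ((treeMeasure p hp).prod (labelMeasure k)).real
    {ω | Represents (offspring ω.1) ω.2 f}

end AndOr

end

/-!
The two bounds have independent proofs.

*Upper bound.* The measure of the event that the infinite tree represents `f` is at most the
supremum over `h` of the probabilities that its truncations at height `h` do, so only the explicit
laws `spineWeight` of the truncations matter (`fullMeasure_represents_le`). These laws are
invariant under renaming the variables and under dualizing. Hence all functions in the orbit of
`f` have the same weight and the same complexity, and there are at least `2 * k.choose (ess f)` of
them, because a function differs from its negation (`orbit_mul_tsum_le`). It remains to see that
the complexity of the represented function has an exponential moment at the scale `k ^ 2` that is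
at most `2`; the factor `2` from negation then makes the bound free of any multiplicative
constant.

For this, the tree is pruned: at a node whose first child is a leaf, the value matters only at
inputs where a certain literal (the *guard*) is true; if an internal child is in turn guarded by
the negation of this literal, it can be replaced by its own first leaf, since it is constant at
the inputs that matter (`BTree.eval_prune`). Given that two successive nodes have leaves as first
children, this happens with probability `1 / (2 * k)`. So pruning makes the branching process
subcritical by an amount of order `1 / k`, and the generating function of the pruned size at `z =
1 + O(1 / k ^ 2)` stays within `O(1 / k)` of `1`: the recursions over the height for the two
states "no guard" and "some guard" have a supersolution `(1 + α, 1 + β)` with `α` and `β` of order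
`1 / k` (`nodeGF_gw_le`). The tree with a spine obeys a linear recursion driven by these
functions, which has a bounded supersolution (`pruneGF_spine_le`).

*Lower bound.* A smallest tree for `f` is turned into a tree of comparable size whose nodes all
have the same number `N + 2` of children, where `p (N + 2) ≠ 0` (`exists_isNary`). With
probability at least `(δ / (2 * k)) ^ (M * complexity f)`, the root is a conjunction of copies of
this tree and of the next node of the spine, and this node is a tautology because a variable and
its negation occur below disjunctions next to the spine (`frame_le_fullMeasure`).

*Read-once functions.* In a read-once tree all variables are essential, so that `ess f =
complexity f` (`ReadOnce.ess_eq_complexity`), and `ε * m * log k ≤ log (k.choose m)` for `m ≤ k ^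
(1 - ε)` (`mul_log_le_log_choose`), which makes the two general bounds comparable.
-/

noncomputable section

namespace AndOr

variable {k : ℕ}

/-! ### Sums over trees -/

/-- A tree is a leaf with its literal, or a connective with a tuple of at least two children. -/
def btreeEquiv (k : ℕ) :
    (Fin k × Bool) ⊕ (Bool × (Σ n : ℕ, Fin (n + 2) → BTree k)) ≃ BTree k where
  toFun
    | .inl l => .leaf l
    | .inr q => .node q.1 q.2.1 q.2.2
  invFun
    | .leaf l => .inl l
    | .node c n ch => .inr (c, ⟨n, ch⟩)
  left_inv := by rintro (l | ⟨c, n, ch⟩) <;> rfl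
  right_inv := by rintro (l | ⟨c, n, ch⟩) <;> rfl

theorem tsum_btree (F : BTree k → ℝ≥0∞) :
    ∑' τ, F τ = ∑ l, F (.leaf l) + ∑ c, ∑' n, ∑' ch, F (.node c n ch) := by
  rw [← (btreeEquiv k).tsum_eq F, Summable.tsum_sum ENNReal.summable ENNReal.summable,
    tsum_fintype, ENNReal.tsum_prod', tsum_fintype]
  congr 1
  refine Finset.sum_congr rfl fun c _ => ?_
  rw [ENNReal.tsum_sigma']
  rfl

/-- Trees as elements of a W-type, whose countability is known. -/
def BTree.toW : BTree k → WType (fun a : (Fin k × Bool) ⊕ (Bool × ℕ) =>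
    Fin (Sum.elim (fun _ => 0) (fun q => q.2 + 2) a))
  | .leaf l => ⟨.inl l, fun j => j.elim0⟩
  | .node c n ch => ⟨.inr (c, n), fun j => (ch j).toW⟩

theorem BTree.toW_injective : Function.Injective (BTree.toW (k := k)) := by
  intro σ
  induction σ with
  | leaf l =>
    rintro (l' | ⟨c', n', ch'⟩) h
    · simp only [BTree.toW, WType.mk.injEq, Sum.inl.injEq] at h
      rw [h.1]
    · simp only [BTree.toW] at h
      injection h with h1
      cases h1
  | node c n ch ih =>
    rintro (l' | ⟨c', n', ch'⟩) h
    · simp only [BTree.toW] at h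
      injection h with h1
      cases h1
    · simp only [BTree.toW, WType.mk.injEq, Sum.inr.injEq, Prod.mk.injEq] at h
      obtain ⟨⟨rfl, rfl⟩, h⟩ := h
      congr
      funext j
      exact ih j (congrFun (eq_of_heq h) j)

instance : Countable (BTree k) := BTree.toW_injective.countable

theorem tsum_pi_prod {β : Type*} : ∀ {m : ℕ} (F : Fin m → β → ℝ≥0∞),
    ∑' v : Fin m → β, ∏ j, F j (v j) = ∏ j, ∑' t, F j t
  | 0, F => by simp
  | m + 1, F => by
    rw [← (Fin.consEquiv fun _ => β).tsum_eq, ENNReal.tsum_prod']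
    simp only [Fin.consEquiv, Equiv.coe_fn_mk, Fin.prod_univ_succ, Fin.cons_zero, Fin.cons_succ,
      ENNReal.tsum_mul_left, ENNReal.tsum_mul_right, tsum_pi_prod fun j => F (Fin.succ j)]

theorem tsum_pi_succ {β : Type*} {m : ℕ} (F : (Fin (m + 1) → β) → ℝ≥0∞) :
    ∑' v, F v = ∑' t, ∑' v : Fin m → β, F (Fin.cons t v) := by
  rw [← (Fin.consEquiv fun _ => β).tsum_eq, ENNReal.tsum_prod']
  rfl

/-! ### Representations and complexity -/

theorem eval_node (c : Bool) (n : ℕ) (ch : Fin (n + 2) → BTree k) (x : Fin k → Bool) :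
    (BTree.node c n ch).eval x = c ↔ ∀ j, (ch j).eval x = c := by
  cases c <;> simp [BTree.eval]

theorem BTree.size_pos : ∀ τ : BTree k, 0 < τ.size
  | .leaf _ => Nat.one_pos
  | .node _ _ ch => by
    rw [BTree.size, Fin.sum_univ_succ]
    exact Nat.add_pos_left (ch 0).size_pos _

theorem complexity_le_size (τ : BTree k) : complexity τ.eval ≤ τ.size := by
  unfold complexity
  split_ifs
  · exact Nat.zero_le _
  · exact Nat.sInf_le ⟨τ, rfl, rfl⟩

/-- The node with two children. -/
def BTree.pair (c : Bool) (σ τ : BTree k) : BTree k := .node c 0 (Fin.cons σ fun _ => τ)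

theorem BTree.eval_pair_true (σ τ : BTree k) : (pair true σ τ).eval = σ.eval ⊓ τ.eval := by
  funext x
  rw [Pi.inf_apply, pair, BTree.eval, Bool.eq_iff_iff]
  simp [Fin.forall_fin_succ]

theorem BTree.eval_pair_false (σ τ : BTree k) : (pair false σ τ).eval = σ.eval ⊔ τ.eval := by
  funext x
  rw [Pi.sup_apply, pair, BTree.eval, Bool.eq_iff_iff]
  simp [Fin.exists_fin_succ]

/-- Every Boolean function is represented by a tree, by its disjunctive normal form. -/
theorem exists_eval_eq [NeZero k] (f : BoolFun k) : ∃ τ : BTree k, τ.eval = f := by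
  have hlit (i : Fin k) (b : Bool) : ∃ τ : BTree k, τ.eval = fun x => x i == b := by
    refine ⟨.leaf (i, b), funext fun x => ?_⟩
    cases b <;> simp [BTree.eval]
  have hbot : ∃ τ : BTree k, τ.eval = ⊥ := by
    obtain ⟨σ, hσ⟩ := hlit 0 true
    obtain ⟨τ, hτ⟩ := hlit 0 false
    refine ⟨.pair true σ τ, ?_⟩
    rw [BTree.eval_pair_true, hσ, hτ]
    funext x
    cases h : x 0 <;> simp [h]
  have htop : ∃ τ : BTree k, τ.eval = ⊤ := by
    obtain ⟨σ, hσ⟩ := hlit 0 true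
    obtain ⟨τ, hτ⟩ := hlit 0 false
    refine ⟨.pair false σ τ, ?_⟩
    rw [BTree.eval_pair_false, hσ, hτ]
    funext x
    cases h : x 0 <;> simp [h]
  have hf : f = Finset.univ.sup fun y : Fin k → Bool =>
      if f y = true then Finset.univ.inf fun i => fun x : Fin k → Bool => x i == y i else ⊥ := by
    funext x
    rw [Finset.sup_apply, Bool.eq_iff_iff]
    constructor
    · intro hx
      refine le_antisymm le_top ?_
      refine le_trans ?_ (Finset.le_sup (Finset.mem_univ x))
      rw [if_pos hx, Finset.inf_apply]
      exact Finset.le_inf fun i _ => by simp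
    · intro hx
      by_contra hfx
      refine absurd hx (ne_of_eq_of_ne (le_antisymm (Finset.sup_le fun y _ => ?_) bot_le)
        (by decide : (⊥ : Bool) ≠ true))
      split_ifs with hy
      · have : y ≠ x := fun h => hfx (h ▸ hy)
        obtain ⟨i, hi⟩ := Function.ne_iff.1 this
        rw [Finset.inf_apply]
        refine (Finset.inf_le (Finset.mem_univ i)).trans ?_
        rw [beq_eq_false_iff_ne.2 hi.symm]
        exact le_rfl
      · exact le_rfl
  rw [hf]
  refine Finset.sup_induction (p := fun g => ∃ τ : BTree k, τ.eval = g) hbot ?_ fun y _ => ?_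
  · rintro _ ⟨σ, rfl⟩ _ ⟨τ, rfl⟩
    exact ⟨_, BTree.eval_pair_false σ τ⟩
  · split_ifs
    · refine Finset.inf_induction (p := fun g => ∃ τ : BTree k, τ.eval = g) htop ?_ fun i _ => hlit i (y i)
      rintro _ ⟨σ, rfl⟩ _ ⟨τ, rfl⟩
      exact ⟨_, BTree.eval_pair_true σ τ⟩
    · exact hbot

theorem exists_size_eq_complexity [NeZero k] {f : BoolFun k} (hf : ¬ IsConst f) :
    ∃ τ : BTree k, τ.eval = f ∧ τ.size = complexity f := by
  rw [complexity, if_neg hf]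
  obtain ⟨τ, hτ⟩ := exists_eval_eq f
  exact Nat.sInf_mem (s := {m | ∃ τ : BTree k, τ.eval = f ∧ τ.size = m}) ⟨_, τ, hτ, rfl⟩

/-! ### Renaming variables and dualizing -/

/-- Rename the variables by `σ` and, if `d` is `true`, exchange the two connectives and negate
all literals. -/
def BTree.act (d : Bool) (σ : Equiv.Perm (Fin k)) : BTree k → BTree k
  | .leaf l => .leaf (σ l.1, l.2 ^^ d)
  | .node c n ch => .node (c ^^ d) n fun j => (ch j).act d σ

theorem BTree.act_act (d : Bool) (σ : Equiv.Perm (Fin k)) (τ : BTree k) :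
    (τ.act d σ).act d σ⁻¹ = τ := by
  induction τ with
  | leaf l => simp [BTree.act]
  | node c n ch ih => simp [BTree.act, ih]

/-- Renaming and dualizing as a permutation of the set of trees. -/
def BTree.actEquiv (d : Bool) (σ : Equiv.Perm (Fin k)) : BTree k ≃ BTree k where
  toFun := BTree.act d σ
  invFun := BTree.act d σ⁻¹
  left_inv τ := BTree.act_act d σ τ
  right_inv τ := by simpa using BTree.act_act d σ⁻¹ τ

/-- The effect of `BTree.act` on the represented function. -/
def BoolFun.act (d : Bool) (σ : Equiv.Perm (Fin k)) (f : BoolFun k) : BoolFun k :=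
  fun x => f (x ∘ σ) ^^ d

theorem BoolFun.act_injective (d : Bool) (σ : Equiv.Perm (Fin k)) :
    Function.Injective (BoolFun.act (k := k) d σ) := by
  intro f g h
  funext x
  have := congrFun h (x ∘ σ.symm)
  simpa [BoolFun.act, Function.comp_assoc] using this

theorem BTree.eval_act (d : Bool) (σ : Equiv.Perm (Fin k)) (τ : BTree k) :
    (τ.act d σ).eval = τ.eval.act d σ := by
  induction τ with
  | leaf l =>
    obtain ⟨i, b⟩ := l
    funext x
    cases b <;> cases d <;> simp [BTree.act, BTree.eval, BoolFun.act]
  | node c n ch ih =>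
    funext x
    have ih' : ∀ j, ((ch j).act d σ).eval x = ((ch j).eval (x ∘ σ) ^^ d) :=
      fun j => congrFun (ih j) x
    cases c <;> cases d <;>
      simp [BTree.act, BTree.eval, BoolFun.act, ih', ← decide_not, -decide_eq_decide]

theorem BTree.size_act (d : Bool) (σ : Equiv.Perm (Fin k)) (τ : BTree k) :
    (τ.act d σ).size = τ.size := by
  induction τ with
  | leaf l => rfl
  | node c n ch ih => simp [BTree.act, BTree.size, ih]

theorem isConst_act (d : Bool) (σ : Equiv.Perm (Fin k)) (f : BoolFun k) :
    IsConst (f.act d σ) ↔ IsConst f := by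
  constructor
  · rintro ⟨b, hb⟩
    refine ⟨b ^^ d, fun x => ?_⟩
    have := hb (x ∘ σ.symm)
    simp only [BoolFun.act, Function.comp_assoc, Equiv.symm_comp_self, Function.comp_id] at this
    rw [← this]; simp
  · rintro ⟨b, hb⟩
    exact ⟨b ^^ d, fun x => by rw [BoolFun.act, hb]⟩

theorem complexity_act (d : Bool) (σ : Equiv.Perm (Fin k)) (f : BoolFun k) :
    complexity (f.act d σ) = complexity f := by
  unfold complexity
  by_cases hf : IsConst f
  · rw [if_pos hf, if_pos ((isConst_act d σ f).2 hf)]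
  rw [if_neg hf, if_neg (mt (isConst_act d σ f).1 hf)]
  congr 1
  ext m
  constructor
  · rintro ⟨τ, hτ, rfl⟩
    refine ⟨(BTree.actEquiv d σ).symm τ, BoolFun.act_injective d σ ?_, ?_⟩
    · rw [← BTree.eval_act, ← hτ]
      exact congrArg _ ((BTree.actEquiv d σ).apply_symm_apply τ)
    · exact BTree.size_act d σ⁻¹ τ
  · rintro ⟨τ, rfl, rfl⟩
    exact ⟨τ.act d σ, BTree.eval_act d σ τ, BTree.size_act d σ τ⟩

theorem isEssential_act (d : Bool) (σ : Equiv.Perm (Fin k)) (f : BoolFun k) (i : Fin k) :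
    IsEssential (f.act d σ) (σ i) ↔ IsEssential f i := by
  have h (x : Fin k → Bool) (b : Bool) :
      Function.update x (σ i) b ∘ σ = Function.update (x ∘ σ) i b := by
    funext j
    simp [Function.update_apply]
  constructor
  · rintro ⟨x, hx⟩
    refine ⟨x ∘ σ, fun hf => hx ?_⟩
    rw [BoolFun.act, BoolFun.act, h, h, hf]
  · rintro ⟨x, hx⟩
    refine ⟨x ∘ σ.symm, fun hf => hx ?_⟩
    rw [BoolFun.act, BoolFun.act, h, h] at hf
    simpa [Function.comp_assoc] using hf

/-! ### Pruning -/

/-- The literal known to be true at all inputs whose value at a node with connective `c` is not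
already decided by its first child `τ`, provided that this child is a leaf. -/
def guard (c : Bool) : BTree k → Option (Fin k × Bool)
  | .leaf l => some (l.1, l.2 == c)
  | .node _ _ _ => none

/-- Two literals of the same variable that are negations of each other. -/
def Contradict (s t : Option (Fin k × Bool)) : Prop :=
  ∃ i b, s = some (i, b) ∧ t = some (i, !b)

open Classical in
/-- Prune a tree whose value matters only where the literal `s` is true. Every node passes to its
children the literal guarding them, and a node whose own guard contradicts `s` is
replaced by its first child, a leaf with the same value at all inputs that matter. -/
def BTree.prune : BTree k → Option (Fin k × Bool) → BTree k
  | .leaf l, _ => .leaf l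
  | .node c n ch, s =>
    if Contradict s (guard c (ch 0)) then ch 0
    else .node c n fun j => (ch j).prune (guard c (ch 0))

/-- The literal `l` is true at `x`. -/
def Holds (s : Option (Fin k × Bool)) (x : Fin k → Bool) : Prop :=
  ∀ l ∈ s, x l.1 = l.2

theorem BTree.eval_prune (τ : BTree k) : ∀ (s : Option (Fin k × Bool)) (x : Fin k → Bool),
    Holds s x → (τ.prune s).eval x = τ.eval x := by
  induction τ with
  | leaf l => intro s x _; rfl
  | node c n ch ih =>
    intro s x hx
    rw [BTree.prune]
    -- inputs not satisfying the guard of this node are decided by its first child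
    have key : ¬ Holds (guard c (ch 0)) x → (ch 0).eval x = !c ∧ ∀ s, (ch 0).prune s = ch 0 := by
      intro h
      cases h0 : ch 0 with
      | leaf l =>
        obtain ⟨i, b⟩ := l
        rw [h0] at h
        simp only [Holds, guard, Option.mem_def, Option.some.injEq, forall_eq'] at h
        refine ⟨?_, fun _ => rfl⟩
        cases b <;> cases c <;> simpa [BTree.eval] using h
      | node c' n' ch' => simp [h0, guard, Holds] at h
    have hdec (ch' : Fin (n + 2) → BTree k) (h : (ch' 0).eval x = !c) :
        (BTree.node c n ch').eval x = !c := by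
      by_contra h'
      have h1 : (BTree.node c n ch').eval x = c := by
        revert h'; cases (BTree.node c n ch').eval x <;> cases c <;> simp
      rw [(eval_node c n ch' x).1 h1 0] at h
      cases c <;> simp at h
    split_ifs with hc
    · obtain ⟨i, b, rfl, hg⟩ := hc
      have : ¬ Holds (guard c (ch 0)) x := by
        intro h
        have h1 := h _ hg
        have h2 := hx _ rfl
        simp only at h1 h2
        rw [h1] at h2
        cases b <;> simp at h2
      rw [(key this).1, hdec ch (key this).1]
    · by_cases hh : Holds (guard c (ch 0)) x
      · have h1 : ∀ j, ((ch j).prune (guard c (ch 0))).eval x = (ch j).eval x :=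
          fun j => ih j _ x hh
        cases c <;> simp only [BTree.eval, h1]
      · rw [hdec ch (key hh).1]
        refine hdec _ ?_
        rw [(key hh).2]
        exact (key hh).1

theorem complexity_eval_le (τ : BTree k) : complexity τ.eval ≤ (τ.prune none).size := by
  have : (τ.prune none).eval = τ.eval :=
    funext fun x => τ.eval_prune none x (by simp [Holds])
  rw [← this]
  exact complexity_le_size _

/-! ### Laws of the truncated trees -/

/-- The probability of a given literal. -/
def litProb (k : ℕ) : ℝ≥0∞ := (Fintype.card (Fin k × Bool) : ℝ≥0∞)⁻¹

theorem card_mul_litProb [NeZero k] : (Fintype.card (Fin k × Bool) : ℝ≥0∞) * litProb k = 1 :=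
  ENNReal.mul_inv_cancel (by simp [NeZero.ne k]) (ENNReal.natCast_ne_top _)

/-- The probability that the labelled unconditioned Galton--Watson tree, truncated at height `h`,
is a given tree. Nodes with a single child do not occur, as they have probability zero. -/
def gwWeight (p : PMF ℕ) : ℕ → BTree k → ℝ≥0∞
  | 0, .leaf _ => litProb k
  | 0, .node _ _ _ => 0
  | _ + 1, .leaf _ => p 0 * litProb k
  | h + 1, .node _ n ch => p (n + 2) * 2⁻¹ * ∏ j, gwWeight p h (ch j)

/-- The probability that the labelled conditioned Galton--Watson tree, truncated at height `h`,
is a given tree. The index `j` is the position of the child on the spine. -/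
def spineWeight (p : PMF ℕ) : ℕ → BTree k → ℝ≥0∞
  | 0, .leaf _ => litProb k
  | 0, .node _ _ _ => 0
  | _ + 1, .leaf _ => 0
  | h + 1, .node _ n ch => p (n + 2) * 2⁻¹ *
      ∑ j, ∏ i, if i = j then spineWeight p h (ch i) else gwWeight p h (ch i)

theorem gwWeight_act (p : PMF ℕ) (d : Bool) (σ : Equiv.Perm (Fin k)) :
    ∀ (h : ℕ) (τ : BTree k), gwWeight p h (τ.act d σ) = gwWeight p h τ
  | 0, .leaf _ => rfl
  | 0, .node _ _ _ => rfl
  | _ + 1, .leaf _ => rfl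
  | h + 1, .node _ n ch => by simp only [BTree.act, gwWeight, gwWeight_act p d σ h]

theorem spineWeight_act (p : PMF ℕ) (d : Bool) (σ : Equiv.Perm (Fin k)) :
    ∀ (h : ℕ) (τ : BTree k), spineWeight p h (τ.act d σ) = spineWeight p h τ
  | 0, .leaf _ => rfl
  | 0, .node _ _ _ => rfl
  | _ + 1, .leaf _ => rfl
  | h + 1, .node _ n ch => by
    simp only [BTree.act, spineWeight, spineWeight_act p d σ h, gwWeight_act p d σ h]

/-! ### Generating functions of pruned trees -/

/-- The generating function of the size of the pruned tree for the weights `w`. -/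
def pruneGF (z : ℝ≥0∞) (w : BTree k → ℝ≥0∞) (s : Option (Fin k × Bool)) : ℝ≥0∞ :=
  ∑' τ, w τ * z ^ (τ.prune s).size

/-- The contribution to `pruneGF` of the trees that are not single leaves. -/
def nodeGF (z : ℝ≥0∞) (w : BTree k → ℝ≥0∞) (s : Option (Fin k × Bool)) : ℝ≥0∞ :=
  ∑ c, ∑' n, ∑' ch, w (.node c n ch) * z ^ ((BTree.node c n ch).prune s).size

/-- The contribution to `nodeGF` of the nodes with connective `c` and `n + 2` children, where the
child `j` has weights `W j`. -/
def tupleGF (z : ℝ≥0∞) (c : Bool) {n : ℕ} (W : Fin (n + 2) → BTree k → ℝ≥0∞)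
    (s : Option (Fin k × Bool)) : ℝ≥0∞ :=
  ∑' ch, (∏ j, W j (ch j)) * z ^ ((BTree.node c n ch).prune s).size

theorem pruneGF_eq (z : ℝ≥0∞) (w : BTree k → ℝ≥0∞) (s : Option (Fin k × Bool)) {ω : ℝ≥0∞}
    (hw : ∀ l, w (.leaf l) = ω) :
    pruneGF z w s = Fintype.card (Fin k × Bool) * (ω * z) + nodeGF z w s := by
  rw [pruneGF, tsum_btree]
  simp [hw, BTree.prune, BTree.size, nodeGF]

open Classical in
/-- Given the first child `t`, the remaining children contribute independently, with the guard
provided by `t`; if the node is pruned, only their total masses remain. -/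
theorem tupleGF_eq (z : ℝ≥0∞) (c : Bool) {n : ℕ} (W : Fin (n + 2) → BTree k → ℝ≥0∞)
    (s : Option (Fin k × Bool)) :
    tupleGF z c W s = ∑' t, W 0 t * if Contradict s (guard c t)
      then z * ∏ j : Fin (n + 1), ∑' τ, W j.succ τ
      else z ^ (t.prune none).size * ∏ j : Fin (n + 1), pruneGF z (W j.succ) (guard c t) := by
  rw [tupleGF, tsum_pi_succ]
  refine tsum_congr fun t => ?_
  simp only [Fin.prod_univ_succ (n := n + 1), Fin.cons_zero, Fin.cons_succ, BTree.prune]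
  split_ifs with hc
  · have ht : t.size = 1 := by
      cases t with
      | leaf l => rfl
      | node c' n' ch' => obtain ⟨i, b, -, h⟩ := hc; cases h
    rw [← tsum_pi_prod, ht, pow_one, ← ENNReal.tsum_mul_left, ← ENNReal.tsum_mul_left]
    exact tsum_congr fun v => by ring
  · have ht : t.prune (guard c t) = t.prune none := by
      cases t <;> rfl
    simp only [BTree.size, Fin.sum_univ_succ (n := n + 1), Fin.cons_zero, Fin.cons_succ, ht,
      pow_add, ← Finset.prod_pow_eq_pow_sum]
    simp only [pruneGF]
    rw [← tsum_pi_prod, ← ENNReal.tsum_mul_left, ← ENNReal.tsum_mul_left]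
    refine tsum_congr fun v => ?_
    rw [Finset.prod_mul_distrib]
    ring

/-- The first child is either a node, which provides no guard, or a leaf. -/
theorem tupleGF_split (z : ℝ≥0∞) (c : Bool) {n : ℕ} (W : Fin (n + 2) → BTree k → ℝ≥0∞)
    (s : Option (Fin k × Bool)) {ω a : ℝ≥0∞} (hω : ∀ l, W 0 (.leaf l) = ω)
    (ha : ∏ j : Fin (n + 1), pruneGF z (W j.succ) none ≤ a) (B : Fin k × Bool → ℝ≥0∞)
    (hB : ∀ l, ¬ Contradict s (guard c (.leaf l)) →
      ∏ j : Fin (n + 1), pruneGF z (W j.succ) (guard c (.leaf l)) ≤ B l)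
    (hB' : ∀ l, Contradict s (guard c (.leaf l)) →
      ∏ j : Fin (n + 1), ∑' τ, W j.succ τ ≤ B l) :
    tupleGF z c W s ≤ nodeGF z (W 0) none * a + ω * z * ∑ l, B l := by
  rw [tupleGF_eq, tsum_btree, add_comm]
  refine add_le_add ?_ ?_
  · simp only [nodeGF, Finset.sum_mul, ← ENNReal.tsum_mul_right]
    refine Finset.sum_le_sum fun c' _ => ENNReal.tsum_le_tsum fun n' =>
      ENNReal.tsum_le_tsum fun ch' => ?_
    rw [if_neg (by rintro ⟨i, b, -, h⟩; cases h), guard, mul_assoc]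
    gcongr
  · rw [Finset.mul_sum]
    refine Finset.sum_le_sum fun l _ => ?_
    rw [hω, mul_assoc]
    split_ifs with h
    · gcongr
      exact hB' l h
    · rw [BTree.prune, BTree.size, pow_one]
      gcongr
      exact hB l h

/-- When nothing is known above the node, no pruning occurs at it. -/
theorem tupleGF_none_le (z : ℝ≥0∞) (c : Bool) {n : ℕ} (W : Fin (n + 2) → BTree k → ℝ≥0∞)
    {ω a b : ℝ≥0∞} (hω : ∀ l, W 0 (.leaf l) = ω)
    (ha : ∏ j : Fin (n + 1), pruneGF z (W j.succ) none ≤ a)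
    (hb : ∀ l, ∏ j : Fin (n + 1), pruneGF z (W j.succ) (some l) ≤ b) :
    tupleGF z c W none ≤
      nodeGF z (W 0) none * a + Fintype.card (Fin k × Bool) * (ω * z) * b := by
  refine (tupleGF_split z c W none hω ha (fun _ => b) (fun l _ => hb _) fun l h => ?_).trans ?_
  · obtain ⟨i, b, h, -⟩ := h
    cases h
  · rw [Finset.sum_const, Finset.card_univ, nsmul_eq_mul]
    exact le_of_eq (by ring)

/-- Exactly one of the literals at the first child leads to pruning. -/
theorem tupleGF_some_le (z : ℝ≥0∞) (c : Bool) {n : ℕ} (W : Fin (n + 2) → BTree k → ℝ≥0∞)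
    (l₀ : Fin k × Bool) {ω a b m : ℝ≥0∞} (hω : ∀ l, W 0 (.leaf l) = ω)
    (ha : ∏ j : Fin (n + 1), pruneGF z (W j.succ) none ≤ a)
    (hb : ∀ l, ∏ j : Fin (n + 1), pruneGF z (W j.succ) (some l) ≤ b)
    (hm : ∏ j : Fin (n + 1), ∑' τ, W j.succ τ ≤ m) :
    tupleGF z c W (some l₀) ≤ nodeGF z (W 0) none * a +
      ω * z * (((Fintype.card (Fin k × Bool) - 1 : ℕ) : ℝ≥0∞) * b + m) := by
  classical
  have key : ∀ l, Contradict (some l₀) (guard c (.leaf l)) ↔ l = (l₀.1, (!l₀.2) == c) := by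
    rintro ⟨i, b⟩
    obtain ⟨i₀, b₀⟩ := l₀
    simp only [Contradict, guard, Option.some.injEq, Prod.mk.injEq]
    constructor
    · rintro ⟨i', b', ⟨rfl, rfl⟩, rfl, h⟩
      refine ⟨rfl, ?_⟩
      cases b <;> cases c <;> cases b₀ <;> simp_all
    · rintro ⟨rfl, rfl⟩
      refine ⟨_, _, ⟨rfl, rfl⟩, rfl, ?_⟩
      cases b₀ <;> cases c <;> rfl
  refine (tupleGF_split z c W (some l₀) hω ha
    (fun l => if l = (l₀.1, (!l₀.2) == c) then m else b) (fun l h => ?_) fun l h => ?_).trans ?_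
  · rw [if_neg (mt (key l).2 h)]
    exact hb _
  · rwa [if_pos ((key l).1 h)]
  · rw [← Finset.sum_erase_add _ _ (Finset.mem_univ (l₀.1, (!l₀.2) == c)), if_pos rfl,
      Finset.sum_congr rfl fun l hl => if_neg (Finset.ne_of_mem_erase hl), Finset.sum_const,
      Finset.card_erase_of_mem (Finset.mem_univ _), Finset.card_univ, nsmul_eq_mul]

/-- The bound for a node without any use of the pruning. -/
theorem tupleGF_le (z : ℝ≥0∞) (c : Bool) {n : ℕ} (W : Fin (n + 2) → BTree k → ℝ≥0∞)
    (s : Option (Fin k × Bool)) {ω a : ℝ≥0∞} (hω : ∀ l, W 0 (.leaf l) = ω)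
    (ha : ∀ s, ∏ j : Fin (n + 1), pruneGF z (W j.succ) s ≤ a)
    (hm : ∏ j : Fin (n + 1), ∑' τ, W j.succ τ ≤ a) :
    tupleGF z c W s ≤ pruneGF z (W 0) none * a := by
  refine (tupleGF_split z c W s hω (ha _) (fun _ => a) (fun l _ => ha _) fun l h => hm).trans ?_
  rw [pruneGF_eq z _ none hω, Finset.sum_const, Finset.card_univ, nsmul_eq_mul]
  exact le_of_eq (by ring)

theorem nodeGF_gwWeight (p : PMF ℕ) (z : ℝ≥0∞) (h : ℕ) (s : Option (Fin k × Bool)) :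
    nodeGF z (gwWeight p (h + 1)) s =
      ∑ c, ∑' n, p (n + 2) * 2⁻¹ * tupleGF z c (fun _ : Fin (n + 2) => gwWeight p h) s := by
  refine Finset.sum_congr rfl fun c _ => tsum_congr fun n => ?_
  rw [tupleGF, ← ENNReal.tsum_mul_left]
  exact tsum_congr fun ch => by rw [gwWeight, mul_assoc]

theorem nodeGF_spineWeight (p : PMF ℕ) (z : ℝ≥0∞) (h : ℕ) (s : Option (Fin k × Bool)) :
    nodeGF z (spineWeight p (h + 1)) s = ∑ c, ∑' n, p (n + 2) * 2⁻¹ * ∑ j,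
      tupleGF z c (fun i : Fin (n + 2) => if i = j then spineWeight p h else gwWeight p h) s := by
  refine Finset.sum_congr rfl fun c _ => tsum_congr fun n => ?_
  simp only [tupleGF]
  rw [← Summable.tsum_finsetSum fun _ _ => ENNReal.summable, ← ENNReal.tsum_mul_left]
  refine tsum_congr fun ch => ?_
  rw [spineWeight, mul_assoc, Finset.sum_mul]
  simp only [ite_apply]

/-- Both connectives having the same bound, the bound holds for the sum over nodes. -/
theorem sum_bool_tsum_le (p : PMF ℕ) {F : Bool → ℕ → ℝ≥0∞} {D : ℕ → ℝ≥0∞}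
    (h : ∀ c n, F c n ≤ D n) :
    ∑ c, ∑' n, p (n + 2) * 2⁻¹ * F c n ≤ ∑' n, p (n + 2) * D n := by
  calc ∑ c, ∑' n, p (n + 2) * 2⁻¹ * F c n
      ≤ ∑ _c : Bool, ∑' n, p (n + 2) * 2⁻¹ * D n := by
        gcongr with c _ n; exact h c n
    _ = ∑' n, p (n + 2) * D n := by
        rw [Finset.sum_const, Finset.card_univ, Fintype.card_bool, nsmul_eq_mul,
          ← ENNReal.tsum_mul_left]
        refine tsum_congr fun n => ?_
        rw [Nat.cast_ofNat, mul_right_comm, mul_left_comm,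
          ENNReal.mul_inv_cancel (by simp) (by simp), mul_one]

/-- The generating function of the number of siblings of the first child of an internal node. Its
value at `1` is the probability `1 - p 0` of an internal node. -/
def sibGF (p : PMF ℕ) (x : ℝ≥0∞) : ℝ≥0∞ := ∑' n, p (n + 2) * x ^ (n + 1)

/-- The derivative of `sibGF`. -/
def sibGF' (p : PMF ℕ) (x : ℝ≥0∞) : ℝ≥0∞ := ∑' n, p (n + 2) * ((n + 1 : ℕ) * x ^ n)

/-- The leaf probability of a Galton--Watson tree truncated at height `h`. -/
def leafMass (p : PMF ℕ) : ℕ → ℝ≥0∞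
  | 0 => 1
  | _ + 1 => p 0

theorem gwWeight_leaf (p : PMF ℕ) (h : ℕ) (l : Fin k × Bool) :
    gwWeight p h (.leaf l) = leafMass p h * litProb k := by
  cases h <;> simp [gwWeight, leafMass]

theorem pruneGF_gwWeight [NeZero k] (p : PMF ℕ) (z : ℝ≥0∞) (h : ℕ) (s : Option (Fin k × Bool)) :
    pruneGF z (gwWeight p h) s = leafMass p h * z + nodeGF z (gwWeight p h) s := by
  rw [pruneGF_eq z _ s (gwWeight_leaf p h), mul_assoc (leafMass p h), mul_left_comm,
    ← mul_assoc _ (litProb k), card_mul_litProb, one_mul]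

section GW

variable (p : PMF ℕ) {z : ℝ≥0∞} {h : ℕ} {a b : ℝ≥0∞}

/-- The recursion over the height for unconditioned trees, without a guard. -/
theorem nodeGF_gw_none_le [NeZero k] (ha : pruneGF z (gwWeight (k := k) p h) none ≤ a)
    (hb : ∀ l, pruneGF z (gwWeight (k := k) p h) (some l) ≤ b) :
    nodeGF z (gwWeight (k := k) p (h + 1)) none ≤
      nodeGF z (gwWeight (k := k) p h) none * sibGF p a + leafMass p h * z * sibGF p b := by
  rw [nodeGF_gwWeight]
  refine (sum_bool_tsum_le p fun c n => tupleGF_none_le z c _ (gwWeight_leaf p h)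
    (a := a ^ (n + 1)) (b := b ^ (n + 1)) ?_ fun l => ?_).trans (le_of_eq ?_)
  · simpa using pow_le_pow_left' ha _
  · simpa using pow_le_pow_left' (hb l) _
  · simp only [sibGF, ← ENNReal.tsum_mul_left, ← ENNReal.tsum_add]
    refine tsum_congr fun n => ?_
    rw [show (Fintype.card (Fin k × Bool) : ℝ≥0∞) * (leafMass p h * litProb k * z) =
      (Fintype.card (Fin k × Bool) * litProb k) * (leafMass p h * z) by ring, card_mul_litProb]
    ring

/-- The recursion over the height for unconditioned trees, with the guard `l₀`. -/
theorem nodeGF_gw_some_le (l₀ : Fin k × Bool) (ha : pruneGF z (gwWeight (k := k) p h) none ≤ a)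
    (hb : ∀ l, pruneGF z (gwWeight (k := k) p h) (some l) ≤ b)
    (hm : ∑' τ : BTree k, gwWeight p h τ ≤ 1) :
    nodeGF z (gwWeight (k := k) p (h + 1)) (some l₀) ≤
      nodeGF z (gwWeight (k := k) p h) none * sibGF p a + leafMass p h * litProb k * z *
        (((Fintype.card (Fin k × Bool) - 1 : ℕ) : ℝ≥0∞) * sibGF p b + sibGF p 1) := by
  rw [nodeGF_gwWeight]
  refine (sum_bool_tsum_le p fun c n => tupleGF_some_le z c _ l₀ (gwWeight_leaf p h)
    (a := a ^ (n + 1)) (b := b ^ (n + 1)) (m := 1 ^ (n + 1)) ?_ (fun l => ?_) ?_).trans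
    (le_of_eq ?_)
  · simpa using pow_le_pow_left' ha _
  · simpa using pow_le_pow_left' (hb l) _
  · simpa using pow_le_pow_left' hm _
  · simp only [sibGF, ← ENNReal.tsum_mul_left, ← ENNReal.tsum_add]
    exact tsum_congr fun n => by ring

theorem prod_ite_succ_eq {n : ℕ} (j : Fin (n + 1)) (x y : ℝ≥0∞) :
    ∏ i : Fin (n + 1), (if i.succ = j.succ then x else y) = x * y ^ n := by
  simp only [Fin.succ_inj]
  rw [Finset.prod_ite, Finset.prod_const, Finset.prod_const, Finset.filter_eq',
    if_pos (Finset.mem_univ j), Finset.card_singleton, pow_one, Finset.filter_ne',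
    Finset.card_erase_of_mem (Finset.mem_univ _), Finset.card_univ, Fintype.card_fin]
  rfl

theorem spineWeight_leaf (p : PMF ℕ) (h : ℕ) (l : Fin k × Bool) :
    spineWeight p h (.leaf l) = if h = 0 then litProb k else 0 := by
  cases h <;> simp [spineWeight]

variable {u v : ℝ≥0∞}

/-- The sum over the positions of the spine: the position of the first child contributes the
first term, the others the rest. -/
theorem nodeGF_spine_aux (s : Option (Fin k × Bool)) {D : ℝ≥0∞} {e : ℝ≥0∞}
    (ha : ∀ s, pruneGF z (gwWeight (k := k) p h) s ≤ a)
    (hm : ∑' τ : BTree k, gwWeight p h τ ≤ a)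
    (hu : pruneGF z (spineWeight (k := k) p h) none ≤ u)
    {X : ℕ → ℝ≥0∞}
    (hX : ∀ c n (j : Fin (n + 1)), tupleGF z c (fun i : Fin (n + 2) =>
      if i = j.succ then spineWeight p h else gwWeight p h) s ≤ D * a ^ n + e * X n) :
    nodeGF z (spineWeight (k := k) p (h + 1)) s ≤ u * sibGF p a + D * sibGF' p a +
      e * ∑' n, p (n + 2) * ((n + 1 : ℕ) * X n) := by
  rw [nodeGF_spineWeight]
  refine (sum_bool_tsum_le p (D := fun n => u * a ^ (n + 1) +
    (n + 1 : ℕ) * (D * a ^ n + e * X n)) fun c n => ?_).trans (le_of_eq ?_)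
  · rw [Fin.sum_univ_succ]
    refine add_le_add ?_ ?_
    · refine (tupleGF_le z c _ s (a := a ^ (n + 1))
        (fun l => (spineWeight_leaf p h l)) (fun s => ?_) ?_).trans ?_
      · simpa [Fin.succ_ne_zero] using pow_le_pow_left' (ha s) _
      · simpa [Fin.succ_ne_zero] using pow_le_pow_left' hm _
      · simp only [if_true]
        gcongr
    · refine (Finset.sum_le_sum fun j _ => hX c n j).trans ?_
      rw [Finset.sum_const, Finset.card_univ, Fintype.card_fin, nsmul_eq_mul]
  · simp only [sibGF, sibGF', ← ENNReal.tsum_mul_left, ← ENNReal.tsum_add]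
    exact tsum_congr fun n => by ring

theorem first_child_leaf (h : ℕ) {n : ℕ} (j : Fin (n + 1)) (l : Fin k × Bool) :
    (if (0 : Fin (n + 2)) = j.succ then spineWeight p h else gwWeight p h) (.leaf l) =
      leafMass p h * litProb k := by
  rw [if_neg (Fin.succ_ne_zero j).symm, gwWeight_leaf]

theorem prod_pruneGF_spine {n : ℕ} (j : Fin (n + 1)) (s : Option (Fin k × Bool))
    (ha : pruneGF z (gwWeight (k := k) p h) s ≤ a)
    (hu : pruneGF z (spineWeight (k := k) p h) s ≤ u) :
    ∏ i : Fin (n + 1), pruneGF z (if i.succ = j.succ then spineWeight (k := k) p h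
      else gwWeight p h) s ≤ u * a ^ n := by
  rw [← prod_ite_succ_eq j]
  refine Finset.prod_le_prod' fun i _ => ?_
  split_ifs <;> assumption

/-- The recursion over the height for conditioned trees, without a guard. -/
theorem nodeGF_spine_none_le [NeZero k]
    (ha : ∀ s, pruneGF z (gwWeight (k := k) p h) s ≤ a)
    (hb : ∀ l, pruneGF z (gwWeight (k := k) p h) (some l) ≤ b)
    (hm : ∑' τ : BTree k, gwWeight p h τ ≤ a)
    (hu : pruneGF z (spineWeight (k := k) p h) none ≤ u)
    (hv : ∀ l, pruneGF z (spineWeight (k := k) p h) (some l) ≤ v) :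
    nodeGF z (spineWeight (k := k) p (h + 1)) none ≤ u * sibGF p a +
      nodeGF z (gwWeight (k := k) p h) none * u * sibGF' p a +
      leafMass p h * z * v * sibGF' p b := by
  refine nodeGF_spine_aux p none ha hm hu (X := fun n => b ^ n) fun c n j => ?_
  have key := tupleGF_none_le z c
    (fun i : Fin (n + 2) => if i = j.succ then spineWeight (k := k) p h else gwWeight p h)
    (ω := leafMass p h * litProb k) (first_child_leaf p h j)
    (prod_pruneGF_spine p j none (ha _) hu)
    fun l => prod_pruneGF_spine p j (some l) (hb l) (hv l)
  refine key.trans (le_of_eq ?_)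
  rw [show (Fintype.card (Fin k × Bool) : ℝ≥0∞) * (leafMass p h * litProb k * z) =
      (Fintype.card (Fin k × Bool) * litProb k) * (leafMass p h * z) by ring, card_mul_litProb,
      if_neg (Fin.succ_ne_zero j).symm]
  ring

/-- The recursion over the height for conditioned trees, with the guard `l₀`. -/
theorem nodeGF_spine_some_le (l₀ : Fin k × Bool)
    (ha : ∀ s, pruneGF z (gwWeight (k := k) p h) s ≤ a)
    (hb : ∀ l, pruneGF z (gwWeight (k := k) p h) (some l) ≤ b)
    (hm : ∑' τ : BTree k, gwWeight p h τ ≤ 1) (h1a : 1 ≤ a)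
    (hm' : ∑' τ : BTree k, spineWeight p h τ ≤ 1)
    (hu : pruneGF z (spineWeight (k := k) p h) none ≤ u)
    (hv : ∀ l, pruneGF z (spineWeight (k := k) p h) (some l) ≤ v) :
    nodeGF z (spineWeight (k := k) p (h + 1)) (some l₀) ≤ u * sibGF p a +
      nodeGF z (gwWeight (k := k) p h) none * u * sibGF' p a +
      leafMass p h * litProb k * z * (((Fintype.card (Fin k × Bool) - 1 : ℕ) : ℝ≥0∞) *
        (v * sibGF' p b) + sibGF' p 1) := by
  refine (nodeGF_spine_aux p (some l₀) ha (hm.trans h1a) hu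
    (D := nodeGF z (gwWeight (k := k) p h) none * u) (e := leafMass p h * litProb k * z)
    (X := fun n => ((Fintype.card (Fin k × Bool) - 1 : ℕ) : ℝ≥0∞) * (v * b ^ n) + 1 ^ n)
    fun c n j => ?_).trans (le_of_eq ?_)
  · have hmass : ∏ i : Fin (n + 1), ∑' τ, (if i.succ = j.succ then spineWeight (k := k) p h
        else gwWeight p h) τ ≤ 1 ^ n := by
      rw [one_pow]
      refine Finset.prod_le_one' fun i _ => ?_
      split_ifs <;> assumption
    have key := tupleGF_some_le z c
      (fun i : Fin (n + 2) => if i = j.succ then spineWeight (k := k) p h else gwWeight p h) l₀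
      (ω := leafMass p h * litProb k) (first_child_leaf p h j)
      (prod_pruneGF_spine p j none (ha _) hu)
      (fun l => prod_pruneGF_spine p j (some l) (hb l) (hv l)) hmass
    refine key.trans (le_of_eq ?_)
    · rw [if_neg (Fin.succ_ne_zero j).symm]
      ring
  · simp only [sibGF', ← ENNReal.tsum_mul_left, ← ENNReal.tsum_add]
    exact congrArg _ (tsum_congr fun n => by ring)

end GW

/-! ### Total masses -/

theorem tsum_nat_eq_add_add (f : ℕ → ℝ≥0∞) : ∑' n, f n = f 0 + f 1 + ∑' n, f (n + 2) := by
  rw [tsum_eq_zero_add' ENNReal.summable, tsum_eq_zero_add' ENNReal.summable, add_assoc]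

theorem tsum_gwWeight_le [NeZero k] (p : PMF ℕ) :
    ∀ h : ℕ, ∑' τ : BTree k, gwWeight p h τ ≤ 1
  | 0 => by
    rw [tsum_btree]
    simpa [gwWeight] using card_mul_litProb.le
  | h + 1 => by
    rw [tsum_btree]
    simp only [gwWeight, ENNReal.tsum_mul_left, tsum_pi_prod]
    calc _ ≤ p 0 + ∑' n, p (n + 2) * 1 := by
          refine add_le_add (le_of_eq ?_) (sum_bool_tsum_le p fun c n => ?_)
          · rw [Finset.sum_const, Finset.card_univ, nsmul_eq_mul, mul_left_comm,
              card_mul_litProb, mul_one]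
          · exact Finset.prod_le_one' fun j _ => tsum_gwWeight_le p h
      _ ≤ ∑' n, p n := by
          rw [tsum_nat_eq_add_add fun n : ℕ => p n]
          simp only [mul_one]
          gcongr
          exact le_self_add
      _ = 1 := p.tsum_coe

theorem tsum_spineWeight_le [NeZero k] (p : PMF ℕ) (hp : ∑' n : ℕ, (n : ℝ≥0∞) * p n = 1) :
    ∀ h : ℕ, ∑' τ : BTree k, spineWeight p h τ ≤ 1
  | 0 => by
    rw [tsum_btree]
    simpa [spineWeight] using card_mul_litProb.le
  | h + 1 => by
    rw [tsum_btree]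
    simp only [spineWeight, ENNReal.tsum_mul_left, Finset.sum_const_zero, zero_add]
    calc _ ≤ ∑' n, p (n + 2) * (n + 2 : ℕ) := by
          refine sum_bool_tsum_le p fun c n => ?_
          rw [Summable.tsum_finsetSum fun _ _ => ENNReal.summable]
          have : ∀ j : Fin (n + 2), (∑' ch : Fin (n + 2) → BTree k, ∏ i,
              if i = j then spineWeight p h (ch i) else gwWeight p h (ch i)) ≤ 1 := by
            intro j
            rw [tsum_pi_prod fun i t => if i = j then spineWeight p h t else gwWeight p h t]
            refine Finset.prod_le_one' fun i _ => ?_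
            split_ifs
            · exact tsum_spineWeight_le p hp h
            · exact tsum_gwWeight_le p h
          simpa using Finset.sum_le_sum fun j (_ : j ∈ Finset.univ) => this j
      _ ≤ ∑' n : ℕ, (n : ℝ≥0∞) * p n := by
          rw [tsum_nat_eq_add_add fun n : ℕ => (n : ℝ≥0∞) * p n]
          exact le_add_left (le_of_eq (tsum_congr fun n => mul_comm _ _))
      _ = 1 := hp

/-! ### Estimates near criticality -/

theorem apply_zero_le_one (p : PMF ℕ) : (p 0).toReal ≤ 1 :=
  ENNReal.toReal_le_of_le_ofReal zero_le_one (by simpa using p.coe_le_one 0)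

section Moments

variable (p : PMF ℕ) (hmean : ∑' n : ℕ, (n : ℝ≥0∞) * p n = 1) (hone : p 1 = 0)
include hmean hone

theorem sibGF_one_add_sibGF'_one : sibGF p 1 + sibGF' p 1 = 1 := by
  refine Eq.trans ?_ hmean
  rw [tsum_nat_eq_add_add fun n : ℕ => (n : ℝ≥0∞) * p n, hone, sibGF, sibGF',
    ← ENNReal.tsum_add]
  simp only [Nat.cast_zero, zero_mul, mul_zero, add_zero, zero_add, one_pow, mul_one]
  refine tsum_congr fun n => ?_
  push_cast
  ring

omit hmean in
theorem add_sibGF_one : p 0 + sibGF p 1 = 1 := by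
  refine Eq.trans ?_ p.tsum_coe
  rw [tsum_nat_eq_add_add fun n : ℕ => p n, hone, sibGF]
  simp

omit hmean in
theorem sibGF_one_eq : sibGF p 1 = ENNReal.ofReal (1 - (p 0).toReal) := by
  have h := add_sibGF_one p hone
  rw [ENNReal.ofReal_sub _ ENNReal.toReal_nonneg, ENNReal.ofReal_one,
    ENNReal.ofReal_toReal (p.apply_ne_top 0)]
  refine ENNReal.eq_sub_of_add_eq (p.apply_ne_top 0) ?_
  rwa [add_comm]

theorem sibGF'_one : sibGF' p 1 = p 0 := by
  have h := (sibGF_one_add_sibGF'_one p hmean hone).trans (add_sibGF_one p hone).symm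
  rw [add_comm (p 0)] at h
  refine (ENNReal.add_right_inj ?_).1 h
  rw [sibGF_one_eq p hone]
  exact ENNReal.ofReal_ne_top

theorem apply_zero_pos : 0 < (p 0).toReal := by
  refine ENNReal.toReal_pos (fun h0 => ?_) (p.apply_ne_top 0)
  have h := sibGF'_one p hmean hone
  rw [h0, sibGF', ENNReal.tsum_eq_zero] at h
  have h1 : ∀ n, p (n + 2) = 0 := by
    intro n
    have := h n
    rw [one_pow, mul_one, mul_eq_zero] at this
    exact this.resolve_right (by exact_mod_cast n.succ_ne_zero)
  have h2 := add_sibGF_one p hone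
  rw [h0, sibGF] at h2
  simp [h1] at h2

omit hmean hone

theorem one_add_pow_le {x y : ℝ} (hx : 0 ≤ x) (hxy : x ≤ y) (m : ℕ) :
    (1 + x) ^ m ≤ 1 + m * x + (m : ℝ) ^ 2 * (1 + y) ^ m * x ^ 2 := by
  induction m with
  | zero => simp
  | succ m ih =>
    have hB : 1 ≤ (1 + y) ^ m := one_le_pow₀ (by linarith)
    have hm : (0 : ℝ) ≤ m := m.cast_nonneg
    calc (1 + x) ^ (m + 1) = (1 + x) ^ m * (1 + x) := pow_succ _ _
      _ ≤ (1 + m * x + (m : ℝ) ^ 2 * (1 + y) ^ m * x ^ 2) * (1 + x) := by gcongr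
      _ = 1 + (m + 1) * x + (m * 1 * 1 + (m : ℝ) ^ 2 * (1 + y) ^ m * (1 + x)) * x ^ 2 := by ring
      _ ≤ 1 + (m + 1) * x + (m * (1 + y) ^ m * (1 + y) +
            (m : ℝ) ^ 2 * (1 + y) ^ m * (1 + y)) * x ^ 2 := by
          have : 1 ≤ 1 + y := by linarith
          gcongr
      _ ≤ 1 + (m + 1) * x + ((m + 1 : ℝ) ^ 2 * (1 + y) ^ (m + 1)) * x ^ 2 := by
          have hy : 0 ≤ (1 + y) ^ m * (1 + y) := by
            have : 0 ≤ 1 + y := by linarith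
            positivity
          rw [pow_succ (1 + y)]
          have : (m : ℝ) * (1 + y) ^ m * (1 + y) + (m : ℝ) ^ 2 * (1 + y) ^ m * (1 + y) ≤
              (m + 1 : ℝ) ^ 2 * ((1 + y) ^ m * (1 + y)) := by nlinarith
          gcongr
      _ = _ := by push_cast; ring

theorem one_add_pow_le' {x y : ℝ} (hx : 0 ≤ x) (hxy : x ≤ y) (m : ℕ) :
    (1 + x) ^ m ≤ 1 + m * (1 + y) ^ m * x := by
  induction m with
  | zero => simp
  | succ m ih =>
    have hB : 1 ≤ (1 + y) ^ (m + 1) := one_le_pow₀ (by linarith)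
    have hy : 0 ≤ 1 + y := by linarith
    calc (1 + x) ^ (m + 1) = (1 + x) ^ m * (1 + x) := pow_succ _ _
      _ ≤ (1 + m * (1 + y) ^ m * x) * (1 + x) := by gcongr
      _ = 1 + (1 + m * ((1 + y) ^ m * (1 + x))) * x := by ring
      _ ≤ 1 + ((1 + y) ^ (m + 1) + m * ((1 + y) ^ m * (1 + y))) * x := by gcongr
      _ = _ := by push_cast; ring

include hmean hone

/-- The expansions of the generating function of the number of siblings and of its derivative
at `1`, where the error terms are controlled by the exponential moment. -/
theorem exists_sibGF_le
    (hexp : ∃ a : ℝ, 0 < a ∧ ∑' n : ℕ, ENNReal.ofReal (Real.exp (a * n)) * p n < ∞) :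
    ∃ K x₀ : ℝ, 0 < K ∧ 0 < x₀ ∧ ∀ x : ℝ, 0 ≤ x → x ≤ x₀ →
      sibGF p (ENNReal.ofReal (1 + x)) ≤
        ENNReal.ofReal (1 - (p 0).toReal + (p 0).toReal * x + K * x ^ 2) ∧
      sibGF' p (ENNReal.ofReal (1 + x)) ≤ ENNReal.ofReal ((p 0).toReal + K * x) := by
  obtain ⟨a, ha, hfin⟩ := hexp
  set y : ℝ := Real.exp (a / 2) - 1 with hy
  have hy1 : 1 + y = Real.exp (a / 2) := by rw [hy]; ring
  have hy0 : 0 < y := by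
    have := Real.add_one_lt_exp (x := a / 2) (by positivity)
    linarith
  -- the square of the number of siblings is absorbed by half of the exponential moment
  have hdom : ∀ n : ℕ, ((n + 1 : ℕ) : ℝ) ^ 2 * (1 + y) ^ (n + 1) ≤
      8 / a ^ 2 * Real.exp (a * (n + 2 : ℕ)) := by
    intro n
    have h1 := Real.quadratic_le_exp_of_nonneg (x := a / 2 * (n + 1 : ℕ)) (by positivity)
    have h2 : ((n + 1 : ℕ) : ℝ) ^ 2 ≤ 8 / a ^ 2 * Real.exp (a / 2 * (n + 1 : ℕ)) := by
      have h3 : (0 : ℝ) ≤ a / 2 * (n + 1 : ℕ) := by positivity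
      rw [div_mul_eq_mul_div, le_div_iff₀ (by positivity)]
      nlinarith
    calc ((n + 1 : ℕ) : ℝ) ^ 2 * (1 + y) ^ (n + 1)
        ≤ 8 / a ^ 2 * Real.exp (a / 2 * (n + 1 : ℕ)) * (1 + y) ^ (n + 1) := by
          have : 0 ≤ 1 + y := by linarith
          gcongr
      _ = 8 / a ^ 2 * Real.exp (a * (n + 1 : ℕ)) := by
          rw [hy1, ← Real.exp_nat_mul, mul_assoc, ← Real.exp_add]
          congr 2; ring
      _ ≤ _ := by
          gcongr; simp
  set T : ℝ≥0∞ := ∑' n, p (n + 2) * ENNReal.ofReal (((n + 1 : ℕ) : ℝ) ^ 2 * (1 + y) ^ (n + 1))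
    with hT
  have hTfin : T ≠ ∞ := by
    refine ne_top_of_le_ne_top (ENNReal.mul_ne_top (ENNReal.ofReal_ne_top (r := 8 / a ^ 2))
      hfin.ne) ?_
    rw [tsum_nat_eq_add_add fun n : ℕ => ENNReal.ofReal (Real.exp (a * n)) * p n, mul_add,
      ← ENNReal.tsum_mul_left]
    refine le_add_left (ENNReal.tsum_le_tsum fun n => ?_)
    rw [← mul_assoc, ← ENNReal.ofReal_mul (by positivity), mul_comm]
    exact mul_le_mul_left (ENNReal.ofReal_le_ofReal (hdom n)) _
  have hπ := apply_zero_pos p hmean hone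
  have hπ1 := apply_zero_le_one p
  have hTK : T ≤ ENNReal.ofReal (T.toReal + 1) := by
    rw [ENNReal.ofReal_add ENNReal.toReal_nonneg zero_le_one, ENNReal.ofReal_toReal hTfin]
    exact le_self_add
  have hp0 : ENNReal.ofReal (p 0).toReal = p 0 := ENNReal.ofReal_toReal (p.apply_ne_top 0)
  refine ⟨T.toReal + 1, y, by positivity, hy0, fun x hx hxy => ⟨?_, ?_⟩⟩
  · calc sibGF p (ENNReal.ofReal (1 + x))
        ≤ ∑' n, (p (n + 2) * 1 ^ (n + 1) +
            p (n + 2) * ((n + 1 : ℕ) * 1 ^ n) * ENNReal.ofReal x +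
            p (n + 2) * ENNReal.ofReal (((n + 1 : ℕ) : ℝ) ^ 2 * (1 + y) ^ (n + 1)) *
              ENNReal.ofReal (x ^ 2)) := by
          refine ENNReal.tsum_le_tsum fun n => ?_
          rw [← ENNReal.ofReal_pow (by positivity)]
          refine (mul_le_mul_right (ENNReal.ofReal_le_ofReal (one_add_pow_le hx hxy (n + 1)))
            _).trans (le_of_eq ?_)
          have : 0 ≤ 1 + y := by linarith
          rw [ENNReal.ofReal_add (by positivity) (by positivity),
            ENNReal.ofReal_add (by positivity) (by positivity),
            ENNReal.ofReal_mul (by positivity), ENNReal.ofReal_mul (by positivity),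
            ENNReal.ofReal_natCast, ENNReal.ofReal_one, one_pow, one_pow]
          ring
      _ = sibGF p 1 + sibGF' p 1 * ENNReal.ofReal x + T * ENNReal.ofReal (x ^ 2) := by
          rw [ENNReal.tsum_add, ENNReal.tsum_add, ENNReal.tsum_mul_right, ENNReal.tsum_mul_right]
          rfl
      _ ≤ _ := by
          rw [sibGF_one_eq p hone, sibGF'_one p hmean hone,
            ENNReal.ofReal_add (by nlinarith) (by positivity),
            ENNReal.ofReal_add (by linarith) (by positivity),
            ENNReal.ofReal_mul (by positivity), ENNReal.ofReal_mul (by positivity), hp0]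
          gcongr
  · calc sibGF' p (ENNReal.ofReal (1 + x))
        ≤ ∑' n, (p (n + 2) * ((n + 1 : ℕ) * 1 ^ n) +
            p (n + 2) * ENNReal.ofReal (((n + 1 : ℕ) : ℝ) ^ 2 * (1 + y) ^ (n + 1)) *
              ENNReal.ofReal x) := by
          refine ENNReal.tsum_le_tsum fun n => ?_
          have hy' : 1 ≤ 1 + y := by linarith
          rw [← ENNReal.ofReal_pow (by positivity), ← ENNReal.ofReal_natCast,
            ← ENNReal.ofReal_mul (by positivity), one_pow, mul_one, mul_assoc,
            ← ENNReal.ofReal_mul (by positivity), ← mul_add,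
            ← ENNReal.ofReal_add (by positivity) (by positivity)]
          gcongr
          calc ((n + 1 : ℕ) : ℝ) * (1 + x) ^ n
              ≤ (n + 1 : ℕ) * (1 + n * (1 + y) ^ n * x) := by
                gcongr; exact one_add_pow_le' hx hxy n
            _ ≤ (n + 1 : ℕ) * (1 + (n + 1 : ℕ) * (1 + y) ^ (n + 1) * x) := by
                gcongr <;> simp
            _ = _ := by ring
      _ = sibGF' p 1 + T * ENNReal.ofReal x := by
          rw [ENNReal.tsum_add, ENNReal.tsum_mul_right]
          rfl
      _ ≤ _ := by
          rw [sibGF'_one p hmean hone, ENNReal.ofReal_add (by positivity) (by positivity),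
            ENNReal.ofReal_mul (by positivity), hp0]
          gcongr

end Moments

section Numeric

variable {π K α β z lam κ : ℝ}

/-- The pair `(1 + α, 1 + β)` is a supersolution of the recursion without a guard; `lam` is the
contribution of the leaves. -/
theorem gw_none_numeric (hπ : 0 ≤ π) (hK : 0 ≤ K) (hβ : 0 ≤ β) (hβα : β ≤ α) (hα : α ≤ 1)
    (hlam : π ≤ lam) (h : (π + 2 * K) * α ^ 2 + π * (z - 1) ≤ π ^ 2 * (α - β)) :
    (1 + α - lam) * (1 - π + π * α + K * α ^ 2) + lam * (1 - π + π * β + K * β ^ 2) ≤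
      1 + α - π * z := by
  have hd : 0 ≤ α - β := sub_nonneg.2 hβα
  have h1 : π ^ 2 * (α - β) ≤ lam * (π * (α - β) + K * ((α - β) * (α + β))) := by
    have : 0 ≤ lam * (K * ((α - β) * (α + β))) := by
      have := hπ.trans hlam
      have := hβ.trans hβα
      positivity
    have : π * (π * (α - β)) ≤ lam * (π * (α - β)) := by gcongr
    nlinarith
  have h2 : α * (K * α ^ 2) ≤ 1 * (K * α ^ 2) := by gcongr
  nlinarith

/-- With a guard, the fraction `κ` of the leaves in first position that lead to pruning lowers the
bound from `1 + α` to `1 + β`. -/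
theorem gw_some_numeric (hπ : 0 ≤ π) (hK : 0 ≤ K) (hβ : 0 ≤ β) (hβα : β ≤ α) (hα : α ≤ 1)
    (hlam : π ≤ lam) (hκ : 0 ≤ κ) (hαβ : α = β + π ^ 2 * κ * β)
    (h : (π + 2 * K) * α ^ 2 + π * (z - 1) ≤ π ^ 2 * (α - β)) :
    (1 + α - lam) * (1 - π + π * α + K * α ^ 2) +
      lam * ((1 - κ) * (1 - π + π * β + K * β ^ 2) + κ * (1 - π)) ≤ 1 + β - π * z := by
  have h1 := gw_none_numeric hπ hK hβ hβα hα hlam h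
  have h2 : π * (κ * (π * β)) ≤ lam * (κ * (π * β + K * β ^ 2)) := by
    have : 0 ≤ K * β ^ 2 := by positivity
    have := hπ.trans hlam
    gcongr
    linarith
  nlinarith

variable {U V : ℝ}

/-- The analogue of `gw_none_numeric` for the linear recursion along the spine. -/
theorem spine_none_numeric (hπ : 0 ≤ π) (hK : 0 ≤ K) (hβ : 0 ≤ β) (hβα : β ≤ α)
    (hα : α ≤ 1) (hlam : π ≤ lam) (hV : 0 ≤ V) (hUV : V ≤ U)
    (h : (2 * π + 3 * K) * α * U ≤ π ^ 2 * (U - V)) :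
    U * (1 - π + π * α + K * α ^ 2) + (1 + α - lam) * U * (π + K * α) +
      lam * V * (π + K * β) ≤ U := by
  have hα0 := hβ.trans hβα
  have hlam0 := hπ.trans hlam
  have hU := hV.trans hUV
  have h1 : lam * V * (π + K * β) ≤ lam * V * (π + K * α) := by gcongr
  have h2 : π * (U - V) * π ≤ lam * (U - V) * (π + K * α) := by
    have : 0 ≤ U - V := sub_nonneg.2 hUV
    have : 0 ≤ K * α := by positivity
    gcongr
    linarith
  have h3 : U * K * α * α ≤ U * K * α * 1 := by gcongr
  nlinarith

/-- The analogue of `gw_some_numeric` for the linear recursion along the spine. -/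
theorem spine_some_numeric (hπ : 0 ≤ π) (hK : 0 ≤ K) (hβ : 0 ≤ β) (hβα : β ≤ α)
    (hα : α ≤ 1) (hlam : π ≤ lam) (hV : 1 ≤ V) (hκ : 0 ≤ κ)
    (hUV : U = V + κ * π ^ 2 * (V - 1))
    (h : (2 * π + 3 * K) * α * U ≤ π ^ 2 * (U - V)) :
    U * (1 - π + π * α + K * α ^ 2) + (1 + α - lam) * U * (π + K * α) +
      lam * ((1 - κ) * (V * (π + K * β)) + κ * π) ≤ V := by
  have hVU : V ≤ U := by
    have : 0 ≤ κ * π ^ 2 * (V - 1) := by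
      have : 0 ≤ V - 1 := by linarith
      positivity
    linarith
  have h1 := spine_none_numeric hπ hK hβ hβα hα hlam (by linarith) hVU h
  have h2 : π * (κ * (π * (V - 1))) ≤ lam * (κ * (V * (π + K * β) - π)) := by
    have h3 : 0 ≤ V - 1 := by linarith
    have h4 : 0 ≤ K * β := by positivity
    have := hπ.trans hlam
    gcongr
    nlinarith
  nlinarith

end Numeric

theorem litProb_eq (k : ℕ) [NeZero k] : litProb k = ENNReal.ofReal (1 / (2 * k)) := by
  have : (0 : ℝ) < k := by exact_mod_cast NeZero.pos k
  rw [litProb, one_div, ENNReal.ofReal_inv_of_pos (by positivity), ENNReal.ofReal_mul zero_le_two]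
  simp [mul_comm]

theorem litProb_mul_card_sub_one (k : ℕ) [NeZero k] :
    litProb k * ((Fintype.card (Fin k × Bool) - 1 : ℕ) : ℝ≥0∞) =
      ENNReal.ofReal (1 - 1 / (2 * k)) := by
  have hk : 0 < k := NeZero.pos k
  have : (0 : ℝ) < k := by exact_mod_cast hk
  rw [litProb_eq, ← ENNReal.ofReal_natCast, ← ENNReal.ofReal_mul (by positivity)]
  congr 1
  rw [Fintype.card_prod, Fintype.card_fin, Fintype.card_bool, Nat.cast_sub (by omega)]
  push_cast
  field_simp

section Bounds

variable {k : ℕ} [NeZero k] (p : PMF ℕ) (hmean : ∑' n : ℕ, (n : ℝ≥0∞) * p n = 1) (hone : p 1 = 0)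
  {K α β z : ℝ}

theorem apply_zero_le_leafMass (h : ℕ) : (p 0).toReal ≤ (leafMass p h).toReal := by
  cases h with
  | zero => exact apply_zero_le_one p
  | succ h => exact le_rfl

theorem leafMass_ne_top (h : ℕ) : leafMass p h ≠ ∞ := by
  cases h with
  | zero => exact ENNReal.one_ne_top
  | succ h => exact p.apply_ne_top 0

theorem leafMass_le_one (h : ℕ) : (leafMass p h).toReal ≤ 1 := by
  cases h with
  | zero => exact le_of_eq ENNReal.toReal_one
  | succ h => exact apply_zero_le_one p

theorem leafMass_mul (h : ℕ) :
    leafMass p h * ENNReal.ofReal z = ENNReal.ofReal ((leafMass p h).toReal * z) := by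
  rw [ENNReal.ofReal_mul ENNReal.toReal_nonneg, ENNReal.ofReal_toReal (leafMass_ne_top p h)]

include hmean hone

/-- Uniformly in the height, the generating functions of pruned unconditioned trees are at most
`1 + α` without a guard and `1 + β` with one. The bounds are stated for the contribution of the
nodes, the one of the leaves being explicit. -/
theorem nodeGF_gw_le (hK : 0 ≤ K) (hβ : 0 ≤ β) (hβα : β ≤ α) (hα : α ≤ 1) (hz : 1 ≤ z)
    (hzβ : z ≤ 1 + β) (hαβ : α = β + (p 0).toReal ^ 2 * (1 / (2 * k)) * β)
    (hcond : ((p 0).toReal + 2 * K) * α ^ 2 + (p 0).toReal * (z - 1) ≤ (p 0).toReal ^ 2 * (α - β))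
    (hG : ∀ x : ℝ, 0 ≤ x → x ≤ α → sibGF p (ENNReal.ofReal (1 + x)) ≤
      ENNReal.ofReal (1 - (p 0).toReal + (p 0).toReal * x + K * x ^ 2)) (h : ℕ) :
    nodeGF (k := k) (ENNReal.ofReal z) (gwWeight p h) none ≤
        ENNReal.ofReal (1 + α - (leafMass p h).toReal * z) ∧
      ∀ l, nodeGF (k := k) (ENNReal.ofReal z) (gwWeight p h) (some l) ≤
        ENNReal.ofReal (1 + β - (leafMass p h).toReal * z) := by
  have hπ := apply_zero_pos p hmean hone
  have hπ1 := apply_zero_le_one p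
  have hk : (0 : ℝ) < k := by exact_mod_cast NeZero.pos k
  have hκ : (0 : ℝ) ≤ 1 / (2 * k) := by positivity
  have hκ1 : (1 : ℝ) / (2 * k) ≤ 1 := by
    rw [div_le_one (by positivity)]
    have : (1 : ℝ) ≤ k := by exact_mod_cast NeZero.one_le
    linarith
  induction h with
  | zero =>
    constructor
    · simp [nodeGF, gwWeight]
    · simp [nodeGF, gwWeight]
  | succ h ih =>
    obtain ⟨ih1, ih2⟩ := ih
    set lam := (leafMass p h).toReal * z with hlam
    have hl0 : (p 0).toReal ≤ lam :=
      (apply_zero_le_leafMass p h).trans (le_mul_of_one_le_right ENNReal.toReal_nonneg hz)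
    have hl1 : lam ≤ 1 + β :=
      (mul_le_of_le_one_left (by linarith) (leafMass_le_one p h)).trans hzβ
    have hlz : leafMass p h * ENNReal.ofReal z = ENNReal.ofReal lam :=
      leafMass_mul p h
    have ha : pruneGF (ENNReal.ofReal z) (gwWeight (k := k) p h) none ≤
        ENNReal.ofReal (1 + α) := by
      rw [pruneGF_gwWeight, hlz]
      refine (add_le_add_right ih1 _).trans (le_of_eq ?_)
      rw [← ENNReal.ofReal_add (by linarith) (by linarith)]
      congr 1; ring
    have hb : ∀ l, pruneGF (ENNReal.ofReal z) (gwWeight (k := k) p h) (some l) ≤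
        ENNReal.ofReal (1 + β) := by
      intro l
      rw [pruneGF_gwWeight, hlz]
      refine (add_le_add_right (ih2 l) _).trans (le_of_eq ?_)
      rw [← ENNReal.ofReal_add (by linarith) (by linarith)]
      congr 1; ring
    have hGa := hG α (hβ.trans hβα) le_rfl
    have hGb := hG β hβ hβα
    have hα0 := hβ.trans hβα
    have hna : 0 ≤ 1 - (p 0).toReal + (p 0).toReal * α + K * α ^ 2 := by
      have : 0 ≤ (p 0).toReal * α + K * α ^ 2 := by positivity
      linarith
    have hnb : 0 ≤ 1 - (p 0).toReal + (p 0).toReal * β + K * β ^ 2 := by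
      have : 0 ≤ (p 0).toReal * β + K * β ^ 2 := by positivity
      linarith
    constructor
    · refine (nodeGF_gw_none_le p ha hb).trans ?_
      rw [hlz]
      refine (add_le_add (mul_le_mul' ih1 hGa) (mul_le_mul_right hGb _)).trans ?_
      rw [← ENNReal.ofReal_mul (by linarith), ← ENNReal.ofReal_mul (by linarith),
        ← ENNReal.ofReal_add (mul_nonneg (by linarith) hna) (mul_nonneg (by linarith) hnb)]
      exact ENNReal.ofReal_le_ofReal (gw_none_numeric hπ.le hK hβ hβα hα hl0 hcond)
    · intro l₀
      refine (nodeGF_gw_some_le p l₀ ha hb (tsum_gwWeight_le p h)).trans ?_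
      rw [sibGF_one_eq p hone, mul_right_comm (leafMass p h), hlz,
        mul_assoc (ENNReal.ofReal lam), mul_add,
        ← mul_assoc (litProb k), litProb_mul_card_sub_one, litProb_eq]
      refine (add_le_add (mul_le_mul' ih1 hGa)
        (mul_le_mul_right (add_le_add_left (mul_le_mul_right hGb _) _) _)).trans ?_
      have h1κ : 0 ≤ 1 - 1 / (2 * (k : ℝ)) := by linarith
      have hq : 0 ≤ 1 - (p 0).toReal := by linarith
      rw [← ENNReal.ofReal_mul (by linarith), ← ENNReal.ofReal_mul h1κ,
        ← ENNReal.ofReal_mul hκ, ← ENNReal.ofReal_add (by positivity) (by positivity),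
        ← ENNReal.ofReal_mul (by linarith),
        ← ENNReal.ofReal_add (mul_nonneg (by linarith) hna)
          (mul_nonneg (by linarith) (by positivity))]
      exact ENNReal.ofReal_le_ofReal
        (gw_some_numeric hπ.le hK hβ hβα hα hl0 hκ hαβ hcond)

variable {U V : ℝ}

/-- Uniformly in the height, the generating functions of pruned conditioned trees are at most `U`
without a guard and `V` with one. -/
theorem pruneGF_spine_le (hK : 0 ≤ K) (hβ : 0 ≤ β) (hβα : β ≤ α) (hα : α ≤ 1) (hz : 1 ≤ z)
    (hzβ : z ≤ 1 + β) (hαβ : α = β + (p 0).toReal ^ 2 * (1 / (2 * k)) * β)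
    (hcond : ((p 0).toReal + 2 * K) * α ^ 2 + (p 0).toReal * (z - 1) ≤ (p 0).toReal ^ 2 * (α - β))
    (hG : ∀ x : ℝ, 0 ≤ x → x ≤ α → sibGF p (ENNReal.ofReal (1 + x)) ≤
      ENNReal.ofReal (1 - (p 0).toReal + (p 0).toReal * x + K * x ^ 2))
    (hH : ∀ x : ℝ, 0 ≤ x → x ≤ α → sibGF' p (ENNReal.ofReal (1 + x)) ≤
      ENNReal.ofReal ((p 0).toReal + K * x))
    (hzV : z ≤ V) (hUV : U = V + 1 / (2 * k) * (p 0).toReal ^ 2 * (V - 1))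
    (hcond' : (2 * (p 0).toReal + 3 * K) * α * U ≤ (p 0).toReal ^ 2 * (U - V)) (h : ℕ) :
    pruneGF (k := k) (ENNReal.ofReal z) (spineWeight p h) none ≤ ENNReal.ofReal U ∧
      ∀ l, pruneGF (k := k) (ENNReal.ofReal z) (spineWeight p h) (some l) ≤ ENNReal.ofReal V := by
  have hπ := apply_zero_pos p hmean hone
  have hπ1 := apply_zero_le_one p
  have hk : (0 : ℝ) < k := by exact_mod_cast NeZero.pos k
  have hκ : (0 : ℝ) ≤ 1 / (2 * k) := by positivity
  have hκ1 : (1 : ℝ) / (2 * k) ≤ 1 := by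
    rw [div_le_one (by positivity)]
    have : (1 : ℝ) ≤ k := by exact_mod_cast NeZero.one_le
    linarith
  have hV1 : 1 ≤ V := hz.trans hzV
  have hVU : V ≤ U := by
    have : 0 ≤ 1 / (2 * k) * (p 0).toReal ^ 2 * (V - 1) := by
      have : 0 ≤ V - 1 := by linarith
      positivity
    linarith
  induction h with
  | zero =>
    have : ∀ s, pruneGF (k := k) (ENNReal.ofReal z) (spineWeight p 0) s = ENNReal.ofReal z := by
      intro s
      rw [pruneGF_eq (ω := litProb k) _ _ _ fun l => rfl, ← mul_assoc, card_mul_litProb]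
      simp [nodeGF, spineWeight]
    simp only [this]
    exact ⟨ENNReal.ofReal_le_ofReal (hzV.trans hVU), fun _ => ENNReal.ofReal_le_ofReal hzV⟩
  | succ h ih =>
    obtain ⟨ihu, ihv⟩ := ih
    obtain ⟨hA, hB⟩ := nodeGF_gw_le (k := k) p hmean hone hK hβ hβα hα hz hzβ hαβ hcond hG h
    set lam := (leafMass p h).toReal * z with hlam
    have hl0 : (p 0).toReal ≤ lam :=
      (apply_zero_le_leafMass p h).trans (le_mul_of_one_le_right ENNReal.toReal_nonneg hz)
    have hl1 : lam ≤ 1 + β :=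
      (mul_le_of_le_one_left (by linarith) (leafMass_le_one p h)).trans hzβ
    have hlz : leafMass p h * ENNReal.ofReal z = ENNReal.ofReal lam :=
      leafMass_mul p h
    have hb : ∀ l, pruneGF (ENNReal.ofReal z) (gwWeight (k := k) p h) (some l) ≤
        ENNReal.ofReal (1 + β) := by
      intro l
      rw [pruneGF_gwWeight, hlz]
      refine (add_le_add_right (hB l) _).trans (le_of_eq ?_)
      rw [← ENNReal.ofReal_add (by linarith) (by linarith)]
      congr 1; ring
    have ha : ∀ s, pruneGF (ENNReal.ofReal z) (gwWeight (k := k) p h) s ≤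
        ENNReal.ofReal (1 + α) := by
      rintro (_ | l)
      · rw [pruneGF_gwWeight, hlz]
        refine (add_le_add_right hA _).trans (le_of_eq ?_)
        rw [← ENNReal.ofReal_add (by linarith) (by linarith)]
        congr 1; ring
      · exact (hb l).trans (ENNReal.ofReal_le_ofReal (by linarith))
    have h1a : (1 : ℝ≥0∞) ≤ ENNReal.ofReal (1 + α) := by
      rw [← ENNReal.ofReal_one]
      exact ENNReal.ofReal_le_ofReal (by linarith)
    have hα0 := hβ.trans hβα
    have hGa := hG α hα0 le_rfl
    have hHa := hH α hα0 le_rfl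
    have hHb := hH β hβ hβα
    have hU0 : 0 ≤ U := by linarith
    have hV0 : 0 ≤ V := by linarith
    have hlam0 : 0 ≤ lam := hπ.le.trans hl0
    have hal : 0 ≤ 1 + α - lam := by linarith
    have hna : 0 ≤ 1 - (p 0).toReal + (p 0).toReal * α + K * α ^ 2 := by
      have : 0 ≤ (p 0).toReal * α + K * α ^ 2 := by positivity
      linarith
    have hpr : ∀ s, pruneGF (k := k) (ENNReal.ofReal z) (spineWeight p (h + 1)) s =
        nodeGF (ENNReal.ofReal z) (spineWeight p (h + 1)) s := by
      intro s
      rw [pruneGF_eq (ω := 0) _ _ _ fun l => rfl]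
      simp
    simp only [hpr]
    constructor
    · refine (nodeGF_spine_none_le p ha hb ((tsum_gwWeight_le p h).trans h1a) ihu ihv).trans ?_
      rw [hlz]
      refine (add_le_add (add_le_add (mul_le_mul_right hGa _)
        (mul_le_mul' (mul_le_mul_left hA _) hHa)) (mul_le_mul_right hHb _)).trans ?_
      rw [← ENNReal.ofReal_mul hU0, ← ENNReal.ofReal_mul hal, ← ENNReal.ofReal_mul (by positivity),
        ← ENNReal.ofReal_mul hlam0, ← ENNReal.ofReal_mul (by positivity),
        ← ENNReal.ofReal_add (by positivity) (by positivity),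
        ← ENNReal.ofReal_add (by positivity) (by positivity)]
      exact ENNReal.ofReal_le_ofReal
        (spine_none_numeric hπ.le hK hβ hβα hα hl0 hV0 hVU hcond')
    · intro l₀
      refine (nodeGF_spine_some_le p l₀ ha hb (tsum_gwWeight_le p h) h1a
        (tsum_spineWeight_le p hmean h) ihu ihv).trans ?_
      rw [sibGF'_one p hmean hone, mul_right_comm (leafMass p h), hlz,
        mul_assoc (ENNReal.ofReal lam), mul_add (litProb k),
        ← mul_assoc (litProb k), litProb_mul_card_sub_one, litProb_eq,
        ← ENNReal.ofReal_toReal (p.apply_ne_top 0)]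
      refine (add_le_add (add_le_add (mul_le_mul_right hGa _)
        (mul_le_mul' (mul_le_mul_left hA _) hHa))
        (mul_le_mul_right (add_le_add_left (mul_le_mul_right (mul_le_mul_right hHb _) _) _)
          _)).trans ?_
      have h1κ : 0 ≤ 1 - 1 / (2 * (k : ℝ)) := by linarith
      rw [← ENNReal.ofReal_mul hU0, ← ENNReal.ofReal_mul hal, ← ENNReal.ofReal_mul (by positivity),
        ← ENNReal.ofReal_mul hV0, ← ENNReal.ofReal_mul h1κ, ← ENNReal.ofReal_mul hκ,
        ← ENNReal.ofReal_add (by positivity) (by positivity),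
        ← ENNReal.ofReal_add (by positivity) (by positivity), ← ENNReal.ofReal_mul hlam0,
        ← ENNReal.ofReal_add (by positivity) (by positivity)]
      exact ENNReal.ofReal_le_ofReal
        (spine_some_numeric hπ.le hK hβ hβα hα hl0 hV1 hκ hUV hcond')

end Bounds

/-- The size of the pruned tree has an exponential moment at the scale `k ^ 2`. -/
theorem exists_pruneGF_spine_le_two (p : PMF ℕ) (hmean : ∑' n : ℕ, (n : ℝ≥0∞) * p n = 1)
    (hone : p 1 = 0)
    (hexp : ∃ a : ℝ, 0 < a ∧ ∑' n : ℕ, ENNReal.ofReal (Real.exp (a * n)) * p n < ∞) :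
    ∃ c : ℝ, 0 < c ∧ ∀ (k : ℕ) [NeZero k] (h : ℕ),
      pruneGF (k := k) (ENNReal.ofReal (Real.exp (c / (k : ℝ) ^ 2))) (spineWeight p h) none ≤
        2 := by
  obtain ⟨K, x₀, hK, hx₀, hGH⟩ := exists_sibGF_le p hmean hone hexp
  have hπ := apply_zero_pos p hmean hone
  have hπ1 := apply_zero_le_one p
  set π := (p 0).toReal with hπdef
  -- `η` is the product of `β` and `k`; the four bounds keep the fixed point equations solvable
  obtain ⟨η, hη, hη1, hη2, hη3, hη4⟩ : ∃ η : ℝ, 0 < η ∧ η ≤ 1 / 2 ∧ 2 * η ≤ x₀ ∧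
      2 * ((4 * (π + 2 * K) + 1) * η) ≤ π ^ 4 ∧ 16 * ((2 * π + 3 * K) * η) ≤ π ^ 4 := by
    have ha : 0 < 2 * (4 * (π + 2 * K) + 1) := by positivity
    have hb : 0 < 16 * (2 * π + 3 * K) := by positivity
    refine ⟨min (min (1 / 2) (x₀ / 2)) (min (π ^ 4 / (2 * (4 * (π + 2 * K) + 1)))
      (π ^ 4 / (16 * (2 * π + 3 * K)))), by positivity, ?_, ?_, ?_, ?_⟩
    · exact (min_le_left _ _).trans (min_le_left _ _)
    · have := (min_le_left (min (1 / 2) (x₀ / 2)) (min (π ^ 4 / (2 * (4 * (π + 2 * K) + 1)))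
        (π ^ 4 / (16 * (2 * π + 3 * K))))).trans (min_le_right _ _)
      linarith
    · have := (min_le_right (min (1 / 2) (x₀ / 2)) (min (π ^ 4 / (2 * (4 * (π + 2 * K) + 1)))
        (π ^ 4 / (16 * (2 * π + 3 * K))))).trans (min_le_left _ _)
      rw [le_div_iff₀ ha] at this
      linarith
    · have := (min_le_right (min (1 / 2) (x₀ / 2)) (min (π ^ 4 / (2 * (4 * (π + 2 * K) + 1)))
        (π ^ 4 / (16 * (2 * π + 3 * K))))).trans (min_le_right _ _)
      rw [le_div_iff₀ hb] at this
      linarith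
  refine ⟨η ^ 2 / 2, by positivity, fun k _ h => ?_⟩
  have hk : (1 : ℝ) ≤ k := by exact_mod_cast NeZero.one_le
  set κ : ℝ := 1 / (2 * k) with hκdef
  have hκ : 0 < κ := by positivity
  have hκ1 : κ ≤ 1 / 2 := by
    rw [hκdef]
    gcongr
    linarith
  set β : ℝ := 2 * η * κ with hβdef
  have hβ : 0 < β := by positivity
  have hβη : β ≤ η := by rw [hβdef]; nlinarith
  set α : ℝ := β + π ^ 2 * κ * β with hαdef
  have hπ2 : π ^ 2 * κ * β ≤ 1 * 1 * β := by
    gcongr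
    · exact pow_le_one₀ hπ.le hπ1
    · linarith
  have hβα : β ≤ α := by
    have : 0 ≤ π ^ 2 * κ * β := by positivity
    linarith
  have hα2 : α ≤ 2 * β := by linarith
  set z := Real.exp (η ^ 2 / 2 / (k : ℝ) ^ 2) with hzdef
  have hz1 : 1 ≤ z := Real.one_le_exp (by positivity)
  have hexp_arg : η ^ 2 / 2 / (k : ℝ) ^ 2 = β ^ 2 / 2 := by
    rw [hβdef, hκdef]
    field_simp
  have hβ1 : β ≤ 1 / 2 := hβη.trans hη1
  have hzβ2 : z - 1 ≤ β ^ 2 := by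
    have h1 : β ^ 2 / 2 ≤ 1 := by nlinarith
    have := Real.abs_exp_sub_one_le (x := β ^ 2 / 2) (by rw [abs_of_nonneg (by positivity)]; exact h1)
    rw [abs_of_nonneg (by positivity : (0 : ℝ) ≤ β ^ 2 / 2)] at this
    have := le_of_abs_le this
    rw [hzdef, hexp_arg]
    linarith
  have hα1 : α ≤ 1 := by linarith
  have hcond : (π + 2 * K) * α ^ 2 + π * (z - 1) ≤ π ^ 2 * (α - β) := by
    calc (π + 2 * K) * α ^ 2 + π * (z - 1) ≤ (π + 2 * K) * (2 * β) ^ 2 + 1 * β ^ 2 := by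
          have : 0 ≤ α := hβ.le.trans hβα
          gcongr
      _ = 2 * ((4 * (π + 2 * K) + 1) * η) * (κ * β) := by rw [hβdef]; ring
      _ ≤ π ^ 4 * (κ * β) := by gcongr
      _ = π ^ 2 * (α - β) := by rw [hαdef]; ring
  set V : ℝ := 3 / 2 with hVdef
  set U : ℝ := V + κ * π ^ 2 * (V - 1) with hUdef
  have hU2 : U ≤ 2 := by
    have : κ * π ^ 2 ≤ 1 * 1 := by
      gcongr
      · linarith
      · exact pow_le_one₀ hπ.le hπ1
    rw [hUdef, hVdef]
    linarith
  have hU0 : 0 ≤ U := by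
    have : 0 ≤ κ * π ^ 2 := by positivity
    rw [hUdef, hVdef]
    linarith
  have hcond' : (2 * π + 3 * K) * α * U ≤ π ^ 2 * (U - V) := by
    calc (2 * π + 3 * K) * α * U ≤ (2 * π + 3 * K) * (2 * β) * 2 := by
          gcongr
      _ = 16 * ((2 * π + 3 * K) * η) * (κ / 2) := by rw [hβdef]; ring
      _ ≤ π ^ 4 * (κ / 2) := by gcongr
      _ = π ^ 2 * (U - V) := by rw [hUdef, hVdef]; ring
  have hx : ∀ x : ℝ, x ≤ α → x ≤ x₀ := fun x hx => by linarith
  refine ((pruneGF_spine_le (k := k) p hmean hone hK.le hβ.le hβα hα1 hz1 (by nlinarith) rfl hcond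
    (fun x h0 h1 => (hGH x h0 (hx x h1)).1) (fun x h0 h1 => (hGH x h0 (hx x h1)).2)
    (by rw [hVdef]; nlinarith : z ≤ V) rfl hcond' h).1).trans ?_
  rw [show (2 : ℝ≥0∞) = ENNReal.ofReal 2 by simp]
  exact ENNReal.ofReal_le_ofReal hU2

/-! ### Events prescribing finitely many coordinates -/

section Constraints

variable {ι X : Type*} [MeasurableSpace X]

/-- The configuration `ω` satisfies a list of constraints on its coordinates. -/
def Satisfies (ω : ι → X) (C : List (ι × Set X)) : Prop := ∀ c ∈ C, ω c.1 ∈ c.2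

/-- The product of the probabilities of the constraints. -/
def mass (μ : Measure X) (C : List (ι × Set X)) : ℝ≥0∞ := (C.map fun c => μ c.2).prod

/-- No coordinate is constrained twice. -/
def NodupKeys (C : List (ι × Set X)) : Prop := (C.map Prod.fst).Nodup

theorem infinitePi_satisfies [DiscreteMeasurableSpace X] (μ : Measure X) [IsProbabilityMeasure μ]
    {C : List (ι × Set X)} (hC : NodupKeys C) :
    Measure.infinitePi (fun _ : ι => μ) {ω | Satisfies ω C} = mass μ C := by
  classical
  have h : {ω : ι → X | Satisfies ω C} =
      Set.pi ((C.map Prod.fst).toFinset : Set ι) fun i => {x | ∀ c ∈ C, c.1 = i → x ∈ c.2} := by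
    ext ω
    simp only [Satisfies, Set.mem_ofPred_eq, Set.mem_pi, List.coe_toFinset, List.mem_map]
    constructor
    · rintro h _ - c hc rfl
      exact h c hc
    · intro h c hc
      exact h c.1 ⟨c, hc, rfl⟩ c hc rfl
  rw [h, Measure.infinitePi_pi _ fun _ _ => MeasurableSet.of_discrete, List.prod_toFinset _ hC,
    List.map_map, mass]
  congr 1
  refine List.map_congr_left fun c hc => congrArg μ ?_
  ext x
  refine ⟨fun hx => hx c hc rfl, fun hx c' hc' h => ?_⟩
  rwa [List.inj_on_of_nodup_map hC hc' hc h]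

omit [MeasurableSpace X] in
theorem satisfies_cons {ω : ι → X} {c : ι × Set X} {C : List (ι × Set X)} :
    Satisfies ω (c :: C) ↔ ω c.1 ∈ c.2 ∧ Satisfies ω C := List.forall_mem_cons

omit [MeasurableSpace X] in
theorem satisfies_append {ω : ι → X} {C D : List (ι × Set X)} :
    Satisfies ω (C ++ D) ↔ Satisfies ω C ∧ Satisfies ω D := List.forall_mem_append

omit [MeasurableSpace X] in
theorem satisfies_flatMap {ω : ι → X} {n : ℕ} {F : Fin n → List (ι × Set X)} :
    Satisfies ω ((List.finRange n).flatMap F) ↔ ∀ j, Satisfies ω (F j) := by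
  simp only [Satisfies, List.mem_flatMap, List.mem_finRange, true_and]
  exact ⟨fun h j c hc => h c ⟨j, hc⟩, fun h c ⟨j, hc⟩ => h j c hc⟩

theorem mass_cons (μ : Measure X) (c : ι × Set X) (C : List (ι × Set X)) :
    mass μ (c :: C) = μ c.2 * mass μ C := by simp [mass]

theorem mass_append (μ : Measure X) (C D : List (ι × Set X)) :
    mass μ (C ++ D) = mass μ C * mass μ D := by simp [mass]

theorem mass_flatMap (μ : Measure X) {n : ℕ} (F : Fin n → List (ι × Set X)) :
    mass μ ((List.finRange n).flatMap F) = ∏ j, mass μ (F j) := by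
  rw [Fin.prod_univ_def]
  generalize List.finRange n = L
  induction L with
  | nil => simp [mass]
  | cons j L ih => rw [List.flatMap_cons, mass_append, ih, List.map_cons, List.prod_cons]

end Constraints

section Words

variable {X : Type*}

theorem suffix_cons_inj {u w : List ℕ} {i j : ℕ} (hi : (i :: u) <:+ w) (hj : (j :: u) <:+ w) :
    i = j := by
  have h := (List.suffix_of_suffix_length_le hi hj (by simp)).eq_of_length (by simp)
  exact (List.cons.inj h).1

/-- All constrained words are descendants of `u`. -/
def Below (u : List ℕ) (C : List (List ℕ × Set X)) : Prop := ∀ c ∈ C, u <:+ c.1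

theorem Below.flatMap {u : List ℕ} {n : ℕ} {F : Fin n → List (List ℕ × Set X)}
    (h : ∀ j, Below (j.1 :: u) (F j)) : Below u ((List.finRange n).flatMap F) := by
  intro c hc
  obtain ⟨j, -, hc⟩ := List.mem_flatMap.1 hc
  exact (List.suffix_cons _ _).trans (h j c hc)

theorem NodupKeys.flatMap {u : List ℕ} {n : ℕ} {F : Fin n → List (List ℕ × Set X)}
    (h : ∀ j, Below (j.1 :: u) (F j)) (hF : ∀ j, NodupKeys (F j)) :
    NodupKeys ((List.finRange n).flatMap F) := by
  rw [NodupKeys, List.map_flatMap, List.nodup_flatMap]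
  refine ⟨fun j _ => hF j, (List.nodup_finRange n).imp fun {i j} hij => ?_⟩
  rw [Function.onFun, List.disjoint_left]
  intro w hi hj
  obtain ⟨c, hc, rfl⟩ := List.mem_map.1 hi
  obtain ⟨d, hd, hcd⟩ := List.mem_map.1 hj
  exact hij (Fin.ext (suffix_cons_inj (h i c hc) (hcd ▸ h j d hd)))

theorem NodupKeys.cons {u : List ℕ} {S : Set X} {n : ℕ} {F : Fin n → List (List ℕ × Set X)}
    (h : ∀ j, Below (j.1 :: u) (F j)) (hF : ∀ j, NodupKeys (F j)) :
    NodupKeys ((u, S) :: (List.finRange n).flatMap F) := by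
  rw [NodupKeys, List.map_cons, List.nodup_cons]
  refine ⟨fun hu => ?_, NodupKeys.flatMap h hF⟩
  obtain ⟨c, hc, hcu⟩ := List.mem_map.1 hu
  obtain ⟨j, -, hc⟩ := List.mem_flatMap.1 hc
  have := (h j c hc).length_le
  rw [hcu] at this
  simp at this

theorem NodupKeys.append {ι : Type*} {C D : List (ι × Set X)} (hC : NodupKeys C)
    (hD : NodupKeys D) (h : ∀ c ∈ C, ∀ d ∈ D, c.1 ≠ d.1) : NodupKeys (C ++ D) := by
  rw [NodupKeys, List.map_append]
  refine List.Nodup.append hC hD (List.disjoint_left.2 fun w hw hw' => ?_)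
  obtain ⟨c, hc, rfl⟩ := List.mem_map.1 hw
  obtain ⟨d, hd, hcd⟩ := List.mem_map.1 hw'
  exact h c hc d hd hcd.symm

end Words

/-! ### Truncations of the random trees -/

/-- The constraints on the offspring numbers under which the truncation at height `h` of the tree
rooted at `u` has the shape of a given tree. They cannot be satisfied if this tree is too high. -/
def offC : ℕ → BTree k → List ℕ → List (List ℕ × Set ℕ)
  | 0, .leaf _, _ => []
  | 0, .node _ _ _, u => [(u, ∅)]
  | _ + 1, .leaf _, u => [(u, {0})]
  | h + 1, .node _ n ch, u =>
    (u, {n + 2}) :: (List.finRange (n + 2)).flatMap fun j => offC h (ch j) (j.1 :: u)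

/-- The constraints on the labels under which the tree rooted at `u` has the labels of a given
tree of the same shape. -/
def labC : BTree k → List ℕ → List (List ℕ × Set (Bool × (Fin k × Bool)))
  | .leaf l, u => [(u, {x | x.2 = l})]
  | .node c n ch, u =>
    (u, {x | x.1 = c}) :: (List.finRange (n + 2)).flatMap fun j => labC (ch j) (j.1 :: u)

theorem below_offC : ∀ (h : ℕ) (τ : BTree k) (u : List ℕ), Below u (offC h τ u)
  | 0, .leaf _, u => by simp [Below, offC]
  | 0, .node _ _ _, u => by simp [Below, offC]
  | h + 1, .leaf _, u => by simp [Below, offC]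
  | h + 1, .node _ n ch, u =>
    List.forall_mem_cons.2 ⟨List.suffix_refl u, Below.flatMap fun j => below_offC h (ch j) _⟩

theorem nodupKeys_offC : ∀ (h : ℕ) (τ : BTree k) (u : List ℕ), NodupKeys (offC h τ u)
  | 0, .leaf _, u => by simp [NodupKeys, offC]
  | 0, .node _ _ _, u => by simp [NodupKeys, offC]
  | h + 1, .leaf _, u => by simp [NodupKeys, offC]
  | h + 1, .node _ n ch, u =>
    NodupKeys.cons (fun j => below_offC h (ch j) _) fun j => nodupKeys_offC h (ch j) _

theorem below_labC : ∀ (τ : BTree k) (u : List ℕ), Below u (labC τ u)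
  | .leaf _, u => by simp [Below, labC]
  | .node _ n ch, u =>
    List.forall_mem_cons.2 ⟨List.suffix_refl u, Below.flatMap fun j => below_labC (ch j) _⟩

theorem nodupKeys_labC : ∀ (τ : BTree k) (u : List ℕ), NodupKeys (labC τ u)
  | .leaf _, u => by simp [NodupKeys, labC]
  | .node _ n ch, u =>
    NodupKeys.cons (fun j => below_labC (ch j) _) fun j => nodupKeys_labC (ch j) _

/-- The factor of `gwWeight` that comes from the offspring numbers. -/
def gwShape (p : PMF ℕ) : ℕ → BTree k → ℝ≥0∞
  | 0, .leaf _ => 1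
  | 0, .node _ _ _ => 0
  | _ + 1, .leaf _ => p 0
  | h + 1, .node _ n ch => p (n + 2) * ∏ j, gwShape p h (ch j)

/-- The factor of `spineWeight` that comes from the offspring numbers. -/
def spineShape (p : PMF ℕ) : ℕ → BTree k → ℝ≥0∞
  | 0, .leaf _ => 1
  | 0, .node _ _ _ => 0
  | _ + 1, .leaf _ => 0
  | h + 1, .node _ n ch => p (n + 2) *
      ∑ j, ∏ i, if i = j then spineShape p h (ch i) else gwShape p h (ch i)

/-- The probability of the labels of a tree. -/
def labWeight : BTree k → ℝ≥0∞
  | .leaf _ => litProb k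
  | .node _ _ ch => 2⁻¹ * ∏ j, labWeight (ch j)

theorem gwShape_mul_labWeight (p : PMF ℕ) :
    ∀ (h : ℕ) (τ : BTree k), gwShape p h τ * labWeight τ = gwWeight p h τ
  | 0, .leaf _ => one_mul _
  | 0, .node _ _ _ => zero_mul _
  | _ + 1, .leaf _ => rfl
  | h + 1, .node _ n ch => by
    simp only [gwShape, labWeight, gwWeight, ← gwShape_mul_labWeight p h, Finset.prod_mul_distrib]
    ring

theorem spineShape_mul_labWeight (p : PMF ℕ) :
    ∀ (h : ℕ) (τ : BTree k), spineShape p h τ * labWeight τ = spineWeight p h τ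
  | 0, .leaf _ => one_mul _
  | 0, .node _ _ _ => zero_mul _
  | _ + 1, .leaf _ => zero_mul _
  | h + 1, .node _ n ch => by
    simp only [spineShape, labWeight, spineWeight, ← gwShape_mul_labWeight p h,
      ← spineShape_mul_labWeight p h, ← ite_mul, Finset.prod_mul_distrib, ← Finset.sum_mul]
    ring

theorem mass_offC (p : PMF ℕ) :
    ∀ (h : ℕ) (τ : BTree k) (u : List ℕ), mass p.toMeasure (offC h τ u) = gwShape p h τ
  | 0, .leaf _, u => by simp [mass, offC, gwShape]
  | 0, .node _ _ _, u => by simp [mass, offC, gwShape]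
  | h + 1, .leaf _, u => by
    simp [mass, offC, gwShape, p.toMeasure_apply_singleton 0 (measurableSet_singleton 0)]
  | h + 1, .node _ n ch, u => by
    rw [offC, mass_cons, mass_flatMap, gwShape,
      p.toMeasure_apply_singleton _ (measurableSet_singleton _)]
    simp only [mass_offC p h]

/-- The law of a single label. -/
abbrev labelLaw (k : ℕ) [NeZero k] : Measure (Bool × (Fin k × Bool)) :=
  (PMF.uniformOfFintype (Bool × (Fin k × Bool))).toMeasure

theorem labelLaw_literal [NeZero k] (l : Fin k × Bool) :
    labelLaw k {x | x.2 = l} = litProb k := by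
  classical
  rw [labelLaw, PMF.toMeasure_uniformOfFintype_apply _ MeasurableSet.of_discrete]
  have h : Fintype.card {x : Bool × (Fin k × Bool) | x.2 = l} = 2 := by
    rw [← Fintype.card_bool]
    exact Fintype.card_congr ⟨fun x => x.1.1, fun c => ⟨(c, l), rfl⟩,
      fun x => Subtype.ext (Prod.ext rfl x.2.symm), fun _ => rfl⟩
  rw [h, Fintype.card_prod, Fintype.card_bool, litProb, Nat.cast_mul,
    ENNReal.div_eq_inv_mul, ENNReal.mul_inv (by simp) (by simp), mul_comm, ← mul_assoc,
    Nat.cast_ofNat, ENNReal.mul_inv_cancel (by simp) (by simp), one_mul]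

theorem labelLaw_connective [NeZero k] (c : Bool) : labelLaw k {x | x.1 = c} = 2⁻¹ := by
  classical
  rw [labelLaw, PMF.toMeasure_uniformOfFintype_apply _ MeasurableSet.of_discrete]
  have h : Fintype.card {x : Bool × (Fin k × Bool) | x.1 = c} = Fintype.card (Fin k × Bool) := by
    exact Fintype.card_congr ⟨fun x => x.1.2, fun l => ⟨(c, l), rfl⟩,
      fun x => Subtype.ext (Prod.ext x.2.symm rfl), fun _ => rfl⟩
  have h0 : (Fintype.card (Fin k × Bool) : ℝ≥0∞) ≠ 0 := by simp [NeZero.ne k]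
  rw [h, Fintype.card_prod Bool, Fintype.card_bool, Nat.cast_mul,
    ENNReal.div_eq_inv_mul, ENNReal.mul_inv (by simp) (by simp), mul_assoc,
    ENNReal.inv_mul_cancel h0 (ENNReal.natCast_ne_top _), mul_one, Nat.cast_ofNat]

theorem mass_labC [NeZero k] :
    ∀ (τ : BTree k) (u : List ℕ), mass (labelLaw k) (labC τ u) = labWeight τ
  | .leaf l, u => by
    rw [labC, mass_cons, labelLaw_literal, labWeight]
    simp [mass]
  | .node c n ch, u => by
    rw [labC, mass_cons, mass_flatMap, labelLaw_connective, labWeight]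
    simp only [mass_labC]

theorem truncation_zero {off : List ℕ → ℕ} (lab : List ℕ → Bool × (Fin k × Bool)) (h : ℕ)
    {u : List ℕ} (hu : off u = 0) : truncation off lab h u = .leaf (lab u).2 := by
  cases h with
  | zero => rfl
  | succ h => rw [truncation, hu]

theorem truncation_add_two {off : List ℕ → ℕ} (lab : List ℕ → Bool × (Fin k × Bool)) (h : ℕ)
    {u : List ℕ} {n : ℕ} (hu : off u = n + 2) : truncation off lab (h + 1) u =
      .node (lab u).1 n fun j => truncation off lab h (j.1 :: u) := by
  rw [truncation, hu]

/-- The constraints are necessary. -/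
theorem satisfies_of_truncation_eq {off : List ℕ → ℕ} {lab : List ℕ → Bool × (Fin k × Bool)}
    (h1 : ∀ u, off u ≠ 1) : ∀ (h : ℕ) (τ : BTree k) (u : List ℕ), truncation off lab h u = τ →
      Satisfies off (offC h τ u) ∧ Satisfies lab (labC τ u)
  | 0, τ, u, hτ => by
    subst hτ
    simp [truncation, offC, labC, Satisfies]
  | h + 1, τ, u, hτ => by
    rcases hu : off u with _ | _ | n
    · rw [truncation_zero lab _ hu] at hτ
      subst hτ
      simp [offC, labC, Satisfies, hu]
    · exact absurd hu (h1 u)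
    · rw [truncation_add_two lab h hu] at hτ
      subst hτ
      rw [offC, labC, satisfies_cons, satisfies_cons, satisfies_flatMap, satisfies_flatMap]
      have ih := fun j : Fin (n + 2) =>
        satisfies_of_truncation_eq (lab := lab) h1 h _ (j.1 :: u) rfl
      exact ⟨⟨hu, fun j => (ih j).1⟩, ⟨rfl, fun j => (ih j).2⟩⟩

/-- The constraints are sufficient, also for truncations at greater heights. -/
theorem truncation_eq_of_satisfies {off : List ℕ → ℕ} {lab : List ℕ → Bool × (Fin k × Bool)} :
    ∀ (H : ℕ) (τ : BTree k) (u : List ℕ), τ.size ≤ H → Satisfies off (offC H τ u) →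
      Satisfies lab (labC τ u) → ∀ h, H ≤ h → truncation off lab h u = τ
  | 0, τ, u, hH, _, _, _, _ => absurd hH (by have := τ.size_pos; omega)
  | H + 1, .leaf l, u, _, h1, h2, h, _ => by
    simp only [offC, labC, Satisfies, List.forall_mem_singleton] at h1 h2
    rw [truncation_zero lab h h1]
    exact congrArg _ h2
  | H + 1, .node c n ch, u, hH, h1, h2, 0, hh => by omega
  | H + 1, .node c n ch, u, hH, h1, h2, h + 1, hh => by
    rw [offC, satisfies_cons, satisfies_flatMap] at h1
    rw [labC, satisfies_cons, satisfies_flatMap] at h2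
    rw [truncation_add_two lab h h1.1]
    have hc : (lab u).1 = c := h2.1
    rw [hc]
    congr
    funext j
    refine truncation_eq_of_satisfies H (ch j) (j.1 :: u) ?_ (h1.2 j) (h2.2 j) h (by omega)
    -- a node has at least two children, so that each of them is smaller than the node
    rw [BTree.size] at hH
    obtain ⟨i, hi⟩ := exists_ne j
    have h3 := Finset.add_le_sum (f := fun j => (ch j).size) (fun _ _ => Nat.zero_le _)
      (Finset.mem_univ i) (Finset.mem_univ j) hi
    have h4 := (ch i).size_pos
    omega

theorem spine_suffix (s : ℕ → ℕ × ℕ) {m n : ℕ} (h : m ≤ n) : spine s m <:+ spine s n := by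
  induction n, h using Nat.le_induction with
  | base => exact List.suffix_refl _
  | succ n _ ih => exact ih.trans (List.suffix_cons _ _)

/-- Descendants of a child off the spine have the unconditioned offspring law. -/
theorem offspring_off_spine (ω : (List ℕ → ℕ) × (ℕ → ℕ × ℕ)) {u w : List ℕ} {i j : ℕ}
    (hs : spine ω.2 (u.length + 1) = j :: u) (hij : i ≠ j) (hw : (i :: u) <:+ w) :
    offspring ω w = ω.1 w := by
  rw [offspring, if_neg]
  intro h
  have h1 := spine_suffix ω.2 (show u.length + 1 ≤ w.length from hw.length_le)
  rw [hs, ← h] at h1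
  exact hij (suffix_cons_inj hw h1)

/-- The configurations without nodes of a single child, where the position of the spine is
admissible. These have probability one. -/
def Regular (ω : (List ℕ → ℕ) × (ℕ → ℕ × ℕ)) : Prop :=
  (∀ u, ω.1 u ≠ 1) ∧ ∀ i, (ω.2 i).2 < (ω.2 i).1 ∧ (ω.2 i).1 ≠ 1

section Law

variable (p : PMF ℕ) (hp : ∑' n : ℕ, (n : ℝ≥0∞) * p n = 1)

theorem sizeBiased_singleton {n j : ℕ} (h : j < n) :
    (sizeBiased p hp).toMeasure {(n, j)} = p n := by
  rw [PMF.toMeasure_apply_singleton _ _ (measurableSet_singleton _)]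
  exact if_pos h

theorem treeMeasure_satisfies {C : List (List ℕ × Set ℕ)} {D : List (ℕ × Set (ℕ × ℕ))}
    (hC : NodupKeys C) (hD : NodupKeys D) :
    treeMeasure p hp {ω | Satisfies ω.1 C ∧ Satisfies ω.2 D} =
      mass p.toMeasure C * mass (sizeBiased p hp).toMeasure D := by
  rw [← infinitePi_satisfies _ hC, ← infinitePi_satisfies _ hD, ← Measure.prod_prod]
  rfl

theorem treeMeasure_not_regular (hone : p 1 = 0) : treeMeasure p hp {ω | ¬ Regular ω} = 0 := by
  have h1 : ∀ u, treeMeasure p hp {ω | ω.1 u = 1} = 0 := by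
    intro u
    have := treeMeasure_satisfies p hp (C := [(u, {1})]) (D := []) (by simp [NodupKeys])
      (by simp [NodupKeys])
    simpa [Satisfies, mass, hone, p.toMeasure_apply_singleton 1 (measurableSet_singleton 1)]
      using this
  have h2 : ∀ i, treeMeasure p hp {ω | ¬ ((ω.2 i).2 < (ω.2 i).1 ∧ (ω.2 i).1 ≠ 1)} = 0 := by
    intro i
    have h3 : (sizeBiased p hp).toMeasure {q | ¬ (q.2 < q.1 ∧ q.1 ≠ 1)} = 0 := by
      rw [PMF.toMeasure_apply_eq_zero_iff _ MeasurableSet.of_discrete, Set.disjoint_left]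
      intro q hq hq'
      rw [PMF.mem_support_iff] at hq
      refine hq ?_
      change (if q.2 < q.1 then p q.1 else 0) = 0
      split_ifs with h
      · by_contra h0
        exact hq' ⟨h, fun h1 => h0 (h1 ▸ hone)⟩
      · rfl
    have := treeMeasure_satisfies p hp (C := [])
      (D := [(i, {q | ¬ (q.2 < q.1 ∧ q.1 ≠ 1)})]) (by simp [NodupKeys]) (by simp [NodupKeys])
    simp only [mass, Satisfies, List.map_nil, List.map_cons, h3, List.prod_cons, zero_mul,
      mul_zero, List.forall_mem_singleton, List.not_mem_nil, false_implies, implies_true,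
      true_and] at this
    exact this
  have : {ω | ¬ Regular ω} ⊆ (⋃ u, {ω | ω.1 u = 1}) ∪
      ⋃ i, {ω : (List ℕ → ℕ) × (ℕ → ℕ × ℕ) | ¬ ((ω.2 i).2 < (ω.2 i).1 ∧ (ω.2 i).1 ≠ 1)} := by
    intro ω hω
    rw [Set.mem_union, Set.mem_iUnion, Set.mem_iUnion]
    by_contra h
    obtain ⟨h1, h2⟩ := not_or.1 h
    exact hω ⟨fun u hu => h1 ⟨u, hu⟩, fun i => not_not.1 fun hi => h2 ⟨i, hi⟩⟩
  refine measure_mono_null this (measure_union_null ?_ ?_)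
  · exact measure_iUnion_null h1
  · exact measure_iUnion_null h2

/-- The shape of the conditioned tree below a node of the spine, given constraints on coordinates
that are irrelevant for it. -/
theorem treeMeasure_shape_le : ∀ (h : ℕ) (τ : BTree k) (u : List ℕ)
    (C : List (List ℕ × Set ℕ)) (D : List (ℕ × Set (ℕ × ℕ))), NodupKeys C → NodupKeys D →
    (∀ c ∈ C, ¬ u <:+ c.1) → (∀ d ∈ D, d.1 < u.length) →
    treeMeasure p hp {ω | Regular ω ∧ (Satisfies ω.1 C ∧ Satisfies ω.2 D) ∧
      spine ω.2 u.length = u ∧ Satisfies (offspring ω) (offC h τ u)} ≤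
    mass p.toMeasure C * mass (sizeBiased p hp).toMeasure D * spineShape p h τ
  | 0, .leaf _, u, C, D, hC, hD, _, _ => by
    rw [spineShape, mul_one, ← treeMeasure_satisfies p hp hC hD]
    exact measure_mono fun ω hω => hω.2.1
  | 0, .node _ _ _, u, C, D, hC, hD, _, _ => by
    refine (measure_mono (t := ∅) fun ω hω => ?_).trans (by simp)
    simpa [offC, Satisfies] using hω.2.2.2
  | h + 1, .leaf _, u, C, D, hC, hD, _, _ => by
    refine (measure_mono (t := ∅) fun ω hω => ?_).trans (by simp)
    obtain ⟨hr, -, hs, ho⟩ := hω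
    simp only [offC, Satisfies, List.forall_mem_singleton, Set.mem_singleton_iff, offspring,
      if_pos hs.symm] at ho
    have := (hr.2 u.length).1
    omega
  | h + 1, .node c n ch, u, C, D, hC, hD, hCu, hDu => by
    let E : Fin (n + 2) → List (List ℕ × Set ℕ) := fun j =>
      (List.finRange (n + 2)).flatMap fun i => if i = j then [] else offC h (ch i) (i.1 :: u)
    have hbelow : ∀ j i : Fin (n + 2),
        Below (i.1 :: u) (if i = j then [] else offC h (ch i) (i.1 :: u)) := by
      intro j i
      split_ifs
      · simp [Below]
      · exact below_offC _ _ _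
    have hcover : {ω | Regular ω ∧ (Satisfies ω.1 C ∧ Satisfies ω.2 D) ∧
        spine ω.2 u.length = u ∧ Satisfies (offspring ω) (offC (h + 1) (.node c n ch) u)} ⊆
        ⋃ j : Fin (n + 2), {ω | Regular ω ∧ (Satisfies ω.1 (C ++ E j) ∧
          Satisfies ω.2 ((u.length, {(n + 2, j.1)}) :: D)) ∧
          spine ω.2 (j.1 :: u).length = j.1 :: u ∧
          Satisfies (offspring ω) (offC h (ch j) (j.1 :: u))} := by
      rintro ω ⟨hr, ⟨hωC, hωD⟩, hs, ho⟩
      rw [offC, satisfies_cons, satisfies_flatMap] at ho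
      have hn : (ω.2 u.length).1 = n + 2 := by
        have := ho.1
        rwa [Set.mem_singleton_iff, offspring, if_pos hs.symm] at this
      have hj : (ω.2 u.length).2 < n + 2 := hn ▸ (hr.2 u.length).1
      have hs' : spine ω.2 (u.length + 1) = (ω.2 u.length).2 :: u := by rw [spine, hs]
      refine Set.mem_iUnion.2 ⟨⟨_, hj⟩, hr, ⟨?_, ?_⟩, hs', ho.2 ⟨_, hj⟩⟩
      · rw [satisfies_append, satisfies_flatMap]
        refine ⟨hωC, fun i => ?_⟩
        split_ifs with hi
        · simp [Satisfies]
        · intro d hd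
          rw [← offspring_off_spine ω hs' (fun h => hi (Fin.ext h)) (below_offC _ _ _ d hd)]
          exact ho.2 i d hd
      · exact satisfies_cons.2 ⟨Prod.ext hn rfl, hωD⟩
    refine ((measure_mono hcover).trans (measure_iUnion_fintype_le _ _)).trans ?_
    rw [spineShape, Finset.mul_sum, Finset.mul_sum]
    refine Finset.sum_le_sum fun j _ => ?_
    refine (treeMeasure_shape_le h (ch j) (j.1 :: u) (C ++ E j)
      ((u.length, {(n + 2, j.1)}) :: D) ?_ ?_ ?_ ?_).trans (le_of_eq ?_)
    · refine hC.append (NodupKeys.flatMap (hbelow j) fun i => ?_) fun c hc d hd hcd => ?_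
      · split_ifs
        · simp [NodupKeys]
        · exact nodupKeys_offC _ _ _
      · exact hCu c hc (hcd ▸ Below.flatMap (hbelow j) d hd)
    · rw [NodupKeys, List.map_cons, List.nodup_cons]
      refine ⟨fun hu => ?_, hD⟩
      obtain ⟨d, hd, hdu⟩ := List.mem_map.1 hu
      exact (hDu d hd).ne hdu
    · refine List.forall_mem_append.2 ⟨fun c hc hj => hCu c hc ((List.suffix_cons _ _).trans hj),
        fun c hc hj => ?_⟩
      obtain ⟨i, -, hc⟩ := List.mem_flatMap.1 hc
      have := hbelow j i c hc
      split_ifs at hc with hi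
      · simp at hc
      · exact hi (Fin.ext (suffix_cons_inj this hj))
    · refine List.forall_mem_cons.2 ⟨by simp, fun d hd => (hDu d hd).trans (by simp)⟩
    · rw [mass_append, mass_flatMap, mass_cons, sizeBiased_singleton p hp j.2]
      have h1 : ∀ i : Fin (n + 2), mass p.toMeasure
          (if i = j then [] else offC h (ch i) (i.1 :: u)) =
          if i = j then 1 else gwShape p h (ch i) := by
        intro i
        split_ifs
        · simp [mass]
        · exact mass_offC p h _ _
      have h2 : (∏ i, if i = j then spineShape p h (ch i) else gwShape p h (ch i)) =
          spineShape p h (ch j) * ∏ i, if i = j then 1 else gwShape p h (ch i) := by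
        rw [← Finset.mul_prod_erase _ _ (Finset.mem_univ j),
          ← Finset.mul_prod_erase _ (fun i => if i = j then 1 else gwShape p h (ch i))
            (Finset.mem_univ j), if_pos rfl, if_pos rfl, one_mul]
        congr 1
        refine Finset.prod_congr rfl fun i hi => ?_
        rw [if_neg (Finset.ne_of_mem_erase hi), if_neg (Finset.ne_of_mem_erase hi)]
      rw [h2]
      simp only [h1]
      ring

variable (k) in
/-- The law of the labelled conditioned Galton--Watson tree. -/
abbrev fullMeasure [NeZero k] :
    Measure (((List ℕ → ℕ) × (ℕ → ℕ × ℕ)) × (List ℕ → Bool × (Fin k × Bool))) :=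
  (treeMeasure p hp).prod (labelMeasure k)

instance : IsProbabilityMeasure (treeMeasure p hp) := by
  unfold treeMeasure; infer_instance

instance [NeZero k] : IsProbabilityMeasure (labelMeasure k) := by
  unfold labelMeasure; infer_instance

theorem fullMeasure_truncation_eq_le [NeZero k] (hone : p 1 = 0) (h : ℕ) (τ : BTree k) :
    fullMeasure k p hp {ω | truncation (offspring ω.1) ω.2 h [] = τ} ≤ spineWeight p h τ := by
  have hsub : {ω : ((List ℕ → ℕ) × (ℕ → ℕ × ℕ)) × (List ℕ → Bool × (Fin k × Bool)) |
      truncation (offspring ω.1) ω.2 h [] = τ} ⊆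
      {ω | ¬ Regular ω} ×ˢ Set.univ ∪
        {ω | Regular ω ∧ (Satisfies ω.1 ([] : List (List ℕ × Set ℕ)) ∧
          Satisfies ω.2 ([] : List (ℕ × Set (ℕ × ℕ)))) ∧ spine ω.2 0 = [] ∧
          Satisfies (offspring ω) (offC h τ [])} ×ˢ {lab | Satisfies lab (labC τ [])} := by
    rintro ⟨ω, lab⟩ hω
    by_cases hr : Regular ω
    · have hne : ∀ u, offspring ω u ≠ 1 := by
        intro u
        rw [offspring]
        split_ifs
        · exact (hr.2 _).2
        · exact hr.1 u
      have := satisfies_of_truncation_eq hne h τ [] hω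
      exact Or.inr ⟨⟨hr, ⟨by simp [Satisfies], by simp [Satisfies]⟩, rfl, this.1⟩, this.2⟩
    · exact Or.inl ⟨hr, Set.mem_univ _⟩
  refine ((measure_mono hsub).trans (measure_union_le _ _)).trans ?_
  rw [Measure.prod_prod, Measure.prod_prod, treeMeasure_not_regular p hp hone, zero_mul, zero_add,
    labelMeasure, infinitePi_satisfies _ (nodupKeys_labC τ []), mass_labC,
    ← spineShape_mul_labWeight]
  gcongr
  refine (treeMeasure_shape_le p hp h τ [] [] [] (by simp [NodupKeys]) (by simp [NodupKeys])
    (by simp) (by simp)).trans (le_of_eq ?_)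
  simp [mass]

/-- The probability to represent `f` is at most the supremum of the probabilities that the
truncations do. -/
theorem fullMeasure_represents_le [NeZero k] (hone : p 1 = 0) (f : BoolFun k) {B : ℝ≥0∞}
    (hB : ∀ h, ∑' τ : {τ : BTree k // τ.eval = f}, spineWeight p h τ.1 ≤ B) :
    fullMeasure k p hp {ω | Represents (offspring ω.1) ω.2 f} ≤ B := by
  have h1 : ∀ h, fullMeasure k p hp
      {ω | (truncation (offspring ω.1) ω.2 h []).eval = f} ≤ B := by
    intro h
    refine le_trans ?_ (hB h)
    have : {ω : ((List ℕ → ℕ) × (ℕ → ℕ × ℕ)) × (List ℕ → Bool × (Fin k × Bool)) |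
        (truncation (offspring ω.1) ω.2 h []).eval = f} ⊆
        ⋃ τ : {τ : BTree k // τ.eval = f}, {ω | truncation (offspring ω.1) ω.2 h [] = τ.1} :=
      fun ω hω => Set.mem_iUnion.2 ⟨⟨_, hω⟩, rfl⟩
    refine ((measure_mono this).trans (measure_iUnion_le _)).trans ?_
    exact ENNReal.tsum_le_tsum fun τ => fullMeasure_truncation_eq_le p hp hone h τ.1
  have h2 : {ω : ((List ℕ → ℕ) × (ℕ → ℕ × ℕ)) × (List ℕ → Bool × (Fin k × Bool)) |
      Represents (offspring ω.1) ω.2 f} =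
      ⋃ H : ℕ, {ω | ∀ h ≥ H, (truncation (offspring ω.1) ω.2 h []).eval = f} := by
    ext ω
    simp [Represents, Filter.eventually_atTop]
  have h3 : Monotone fun H : ℕ =>
      {ω : ((List ℕ → ℕ) × (ℕ → ℕ × ℕ)) × (List ℕ → Bool × (Fin k × Bool)) |
        ∀ h ≥ H, (truncation (offspring ω.1) ω.2 h []).eval = f} :=
    fun H H' hH ω hω h hh => hω h (hH.trans hh)
  rw [h2, h3.measure_iUnion]
  refine iSup_le fun H => le_trans (measure_mono ?_) (h1 H)
  exact fun ω hω => hω H le_rfl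

end Law

/-! ### The upper bound -/

/-- Every set of variables of the right size is the set of essential variables of a function
obtained from `f` by renaming variables. -/
theorem exists_perm_isEssential_iff (f : BoolFun k) {E : Finset (Fin k)} (hE : E.card = ess f) :
    ∃ σ : Equiv.Perm (Fin k), ∀ i, IsEssential f i ↔ σ i ∈ E := by
  classical
  have hcard : Fintype.card {i // IsEssential f i} = Fintype.card {i // i ∈ E} := by
    rw [Fintype.card_coe, hE, ess, Set.ncard_eq_toFinset_card', Set.toFinset_card]
    rfl
  let e := Fintype.equivOfCardEq hcard
  refine ⟨e.extendSubtype, fun i => ⟨fun hi => e.extendSubtype_mem i hi, fun hi => ?_⟩⟩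
  by_contra h
  exact e.extendSubtype_not_mem i h hi

/-- The weight of the trees representing a function is invariant under the symmetries. -/
theorem tsum_spineWeight_act (p : PMF ℕ) (h : ℕ) (f : BoolFun k) (d : Bool)
    (σ : Equiv.Perm (Fin k)) :
    ∑' τ : {τ : BTree k // τ.eval = f.act d σ}, spineWeight p h τ.1 =
      ∑' τ : {τ : BTree k // τ.eval = f}, spineWeight p h τ.1 := by
  have hiff : ∀ τ : BTree k, τ.eval = f ↔ (BTree.actEquiv d σ τ).eval = f.act d σ := by
    intro τ
    change _ ↔ (τ.act d σ).eval = _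
    rw [BTree.eval_act]
    exact (BoolFun.act_injective d σ).eq_iff.symm
  rw [← Equiv.tsum_eq ((BTree.actEquiv d σ).subtypeEquiv hiff)]
  exact tsum_congr fun τ => spineWeight_act p d σ h τ.1

/-- The orbit of `f` has at least `2 * k.choose (ess f)` elements, as a function differs from its
negation. All of them have the same complexity and the same probability. -/
theorem orbit_mul_tsum_le (p : PMF ℕ) (h : ℕ) (f : BoolFun k) {z : ℝ≥0∞} (hz : 1 ≤ z) :
    ((k.choose (ess f) * 2 : ℕ) : ℝ≥0∞) *
      ((∑' τ : {τ : BTree k // τ.eval = f}, spineWeight p h τ.1) * z ^ complexity f) ≤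
    pruneGF z (spineWeight (k := k) p h) none := by
  classical
  let I := {E : Finset (Fin k) // E ∈ Finset.powersetCard (ess f) Finset.univ} × Bool
  have hσ : ∀ E : {E : Finset (Fin k) // E ∈ Finset.powersetCard (ess f) Finset.univ},
      ∃ σ : Equiv.Perm (Fin k), ∀ i, IsEssential f i ↔ σ i ∈ E.1 := fun E =>
    exists_perm_isEssential_iff f (Finset.mem_powersetCard.1 E.2).2
  choose σ hσ using hσ
  let F : I → BoolFun k := fun q => f.act q.2 (σ q.1)
  have hess : ∀ (q : I) (j : Fin k), IsEssential (F q) j ↔ j ∈ q.1.1 := by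
    intro q j
    have := isEssential_act q.2 (σ q.1) f ((σ q.1).symm j)
    rw [Equiv.apply_symm_apply] at this
    rw [this, hσ q.1, Equiv.apply_symm_apply]
  have hF : Function.Injective F := by
    rintro ⟨E, d⟩ ⟨E', d'⟩ hEE
    have hE : E = E' := by
      refine Subtype.ext (Finset.ext fun j => ?_)
      rw [← hess (E, d) j, ← hess (E', d') j, hEE]
    subst hE
    have := congrFun hEE fun _ => true
    simp only [F, BoolFun.act] at this
    rw [Bool.xor_right_inj.1 this]
  have hcard : Fintype.card I = k.choose (ess f) * 2 := by
    rw [Fintype.card_prod, Fintype.card_bool, Fintype.card_coe, Finset.card_powersetCard,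
      Finset.card_univ, Fintype.card_fin]
  rw [← hcard, ← nsmul_eq_mul, ← Finset.card_univ, ← Finset.sum_const]
  have hQ : ∀ q : I, (∑' τ : {τ : BTree k // τ.eval = f}, spineWeight p h τ.1) *
      z ^ complexity f =
      ∑' τ : {τ : BTree k // τ.eval = F q}, spineWeight p h τ.1 * z ^ complexity τ.1.eval := by
    intro q
    rw [← tsum_spineWeight_act p h f q.2 (σ q.1), ← ENNReal.tsum_mul_right]
    refine tsum_congr fun τ => ?_
    rw [τ.2, complexity_act]
  rw [Finset.sum_congr rfl fun q _ => hQ q, ← tsum_fintype (L := .unconditional _),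
    ← ENNReal.tsum_sigma fun (q : I) (τ : {τ : BTree k // τ.eval = F q}) =>
      spineWeight p h τ.1 * z ^ complexity τ.1.eval]
  have hinj : Function.Injective fun q : Σ q : I, {τ : BTree k // τ.eval = F q} => q.2.1 := by
    rintro ⟨q, τ, hτ⟩ ⟨q', τ', hτ'⟩ h
    obtain rfl : τ = τ' := h
    obtain rfl : q = q' := hF (hτ.symm.trans hτ')
    rfl
  refine (ENNReal.tsum_comp_le_tsum_of_injective hinj
    fun τ => spineWeight p h τ * z ^ complexity τ.eval).trans ?_
  refine ENNReal.tsum_le_tsum fun τ => ?_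
  gcongr
  exact complexity_eval_le τ

theorem exists_prob_le (p : PMF ℕ) (hmean : ∑' n : ℕ, (n : ℝ≥0∞) * p n = 1) (hone : p 1 = 0)
    (hexp : ∃ a : ℝ, 0 < a ∧ ∑' n : ℕ, ENNReal.ofReal (Real.exp (a * n)) * p n < ∞) :
    ∃ c : ℝ, 0 < c ∧ ∀ (k : ℕ) [NeZero k] (f : BoolFun k), prob p hmean k f ≤
      Real.exp (-c * complexity f / (k : ℝ) ^ 2 - Real.log (k.choose (ess f))) := by
  obtain ⟨c, hc, hbound⟩ := exists_pruneGF_spine_le_two p hmean hone hexp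
  refine ⟨c, hc, fun k _ f => ?_⟩
  have hess : ess f ≤ k := by
    have := Set.ncard_le_ncard (Set.subset_univ {i : Fin k | IsEssential f i})
    rwa [Set.ncard_univ, Nat.card_eq_fintype_card, Fintype.card_fin] at this
  have hC : (0 : ℝ) < k.choose (ess f) := by exact_mod_cast Nat.choose_pos hess
  refine ENNReal.toReal_le_of_le_ofReal (Real.exp_pos _).le ?_
  refine fullMeasure_represents_le p hmean hone f fun h => ?_
  set z := Real.exp (c / (k : ℝ) ^ 2) with hz
  have hz1 : 1 ≤ ENNReal.ofReal z := by
    rw [← ENNReal.ofReal_one]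
    exact ENNReal.ofReal_le_ofReal (Real.one_le_exp (by positivity))
  have key := (orbit_mul_tsum_le p h f hz1).trans (hbound k h)
  set Q := ∑' τ : {τ : BTree k // τ.eval = f}, spineWeight p h τ.1
  have hrw : Real.exp (-c * complexity f / (k : ℝ) ^ 2 - Real.log (k.choose (ess f))) =
      2 / (k.choose (ess f) * 2 * z ^ complexity f) := by
    rw [Real.exp_sub, Real.exp_log hC, hz, ← Real.exp_nat_mul,
      show -c * (complexity f : ℝ) / (k : ℝ) ^ 2 = -(complexity f * (c / (k : ℝ) ^ 2)) by ring,
      Real.exp_neg]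
    field_simp
  have hpos : 0 < (k.choose (ess f) : ℝ) * 2 * z ^ complexity f := by positivity
  rw [hrw, ENNReal.ofReal_div_of_pos hpos, ENNReal.le_div_iff_mul_le
    (Or.inl (ENNReal.ofReal_pos.2 hpos).ne') (Or.inl ENNReal.ofReal_ne_top)]
  refine (le_of_eq ?_).trans (key.trans (by simp))
  rw [ENNReal.ofReal_mul (by positivity), ENNReal.ofReal_pow (Real.exp_pos _).le,
    ENNReal.ofReal_mul hC.le, ENNReal.ofReal_natCast]
  push_cast
  rw [ENNReal.ofReal_ofNat]
  ring

/-! ### Trees of constant arity -/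

/-- All internal nodes have `N + 2` children. -/
def IsNary (N : ℕ) : BTree k → Prop
  | .leaf _ => True
  | .node _ n ch => n = N ∧ ∀ j, IsNary N (ch j)

/-- A node with `N + 2` children, all but the first of which are equal. -/
def BTree.fork (N : ℕ) (c : Bool) (σ τ : BTree k) : BTree k :=
  .node c N (Fin.cons σ fun _ => τ)

theorem BTree.eval_fork (N : ℕ) (c : Bool) (σ τ : BTree k) (x : Fin k → Bool) :
    (fork N c σ τ).eval x = c ↔ σ.eval x = c ∧ τ.eval x = c := by
  rw [fork, eval_node, Fin.forall_fin_succ]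
  simp

theorem BTree.size_fork (N : ℕ) (c : Bool) (σ τ : BTree k) :
    (fork N c σ τ).size = σ.size + (N + 1) * τ.size := by
  simp [fork, BTree.size, Fin.sum_univ_succ]

theorem isNary_fork {N : ℕ} {c : Bool} {σ τ : BTree k} (hσ : IsNary N σ) (hτ : IsNary N τ) :
    IsNary N (BTree.fork N c σ τ) := by
  refine ⟨rfl, fun j => ?_⟩
  refine Fin.cases ?_ (fun j => ?_) j
  · exact hσ
  · exact hτ

section Lower

variable [NeZero k]

/-- A tree whose value is constantly `c`. -/
def BTree.const (N : ℕ) (c : Bool) : BTree k :=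
  fork N (!c) (.leaf (0, true)) (.leaf (0, false))

theorem BTree.eval_const (N : ℕ) (c : Bool) (x : Fin k → Bool) :
    (const (k := k) N c).eval x = c := by
  by_contra h
  have h' : (const (k := k) N c).eval x = !c := by
    revert h; cases (const (k := k) N c).eval x <;> cases c <;> simp
  have := (eval_fork N (!c) _ _ x).1 h'
  revert this
  cases hx : x 0 <;> cases c <;> simp [BTree.eval, hx]

/-- A node of arity `N + 2` for the connective `c` applied to two trees, filled up by constants. -/
def BTree.comb (N : ℕ) (c : Bool) (σ τ : BTree k) : BTree k :=
  .node c N (Fin.cons σ (Fin.cons τ fun _ => const N c))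

theorem BTree.eval_comb (N : ℕ) (c : Bool) (σ τ : BTree k) (x : Fin k → Bool) :
    (comb N c σ τ).eval x = c ↔ σ.eval x = c ∧ τ.eval x = c := by
  rw [comb, eval_node, Fin.forall_fin_succ, Fin.forall_fin_succ]
  simp [BTree.eval_const]

theorem BTree.size_comb (N : ℕ) (c : Bool) (σ τ : BTree k) :
    (comb N c σ τ).size = σ.size + τ.size + N * (N + 2) := by
  simp only [comb, BTree.size, Fin.sum_univ_succ, Fin.cons_zero, Fin.cons_succ, const, size_fork]
  simp
  ring

theorem isNary_comb {N : ℕ} {c : Bool} {σ τ : BTree k} (hσ : IsNary N σ) (hτ : IsNary N τ) :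
    IsNary N (BTree.comb N c σ τ) := by
  refine ⟨rfl, fun j => ?_⟩
  refine Fin.cases ?_ (fun j => ?_) j
  · exact hσ
  · refine Fin.cases ?_ (fun j => ?_) j
    · exact hτ
    · exact isNary_fork trivial trivial

/-- A tuple of trees can be joined by a connective, using only nodes of arity `N + 2`. -/
theorem exists_isNary_join (N : ℕ) (c : Bool) : ∀ (m : ℕ) (ch : Fin (m + 1) → BTree k),
    (∀ j, IsNary N (ch j)) → ∃ τ : BTree k, IsNary N τ ∧
      (∀ x, τ.eval x = c ↔ ∀ j, (ch j).eval x = c) ∧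
      τ.size = ∑ j, (ch j).size + m * (N * (N + 2))
  | 0, ch, h => ⟨ch 0, h 0, fun x => by simp, by simp⟩
  | m + 1, ch, h => by
    obtain ⟨τ, h1, h2, h3⟩ := exists_isNary_join N c m (fun j => ch j.succ) fun j => h j.succ
    refine ⟨.comb N c (ch 0) τ, isNary_comb (h 0) h1, fun x => ?_, ?_⟩
    · rw [BTree.eval_comb, h2, Fin.forall_fin_succ (n := m + 1)]
    · rw [BTree.size_comb, h3, Fin.sum_univ_succ (n := m + 1)]
      ring

theorem eq_of_eq_iff {a b c : Bool} (h : a = c ↔ b = c) : a = b := by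
  revert h; cases a <;> cases b <;> cases c <;> simp

/-- Every tree can be replaced by one of constant arity of comparable size. -/
theorem exists_isNary (N : ℕ) : ∀ τ : BTree k, ∃ τ' : BTree k, IsNary N τ' ∧ τ'.eval = τ.eval ∧
    τ'.size + N * (N + 2) ≤ (1 + N * (N + 2)) * τ.size
  | .leaf l => ⟨.leaf l, trivial, rfl, by simp [BTree.size]⟩
  | .node c n ch => by
    choose ch' h1 h2 h3 using fun j => exists_isNary N (ch j)
    obtain ⟨τ, g1, g2, g3⟩ := exists_isNary_join N c (n + 1) ch' h1
    refine ⟨τ, g1, funext fun x => eq_of_eq_iff (c := c) ?_, ?_⟩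
    · rw [g2, eval_node]
      simp only [h2]
    · rw [g3, BTree.size, Finset.mul_sum]
      refine le_trans (le_of_eq ?_) (Finset.sum_le_sum fun j _ => h3 j)
      rw [Finset.sum_add_distrib, Finset.sum_const, Finset.card_univ, Fintype.card_fin,
        smul_eq_mul]
      ring

theorem litProb_le_half : litProb k ≤ 2⁻¹ := by
  rw [litProb]
  refine ENNReal.inv_le_inv.2 ?_
  have : 0 < k := NeZero.pos k
  rw [Fintype.card_prod, Fintype.card_fin, Fintype.card_bool]
  exact_mod_cast Nat.le_mul_of_pos_left 2 this

theorem pow_le_gwWeight (p : PMF ℕ) {N : ℕ} {δ : ℝ≥0∞} (hδ0 : δ ≤ p 0) (hδN : δ ≤ p (N + 2)) :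
    ∀ (H : ℕ) (τ : BTree k), IsNary N τ → τ.size ≤ H →
      (δ * litProb k) ^ (2 * τ.size - 1) ≤ gwWeight p H τ
  | 0, τ, _, hH => absurd hH (by have := τ.size_pos; omega)
  | H + 1, .leaf l, _, _ => by
    simp only [BTree.size, gwWeight, mul_one, Nat.add_one_sub_one, pow_one]
    gcongr
  | H + 1, .node c n ch, hN, hH => by
    obtain ⟨rfl, hch⟩ := hN
    have hθ : δ * litProb k ≤ 1 :=
      mul_le_one' (hδ0.trans (p.coe_le_one 0)) (litProb_le_half.trans (by simp))
    have hsize : ∀ j, (ch j).size ≤ H := by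
      intro j
      rw [BTree.size] at hH
      obtain ⟨i, hi⟩ := exists_ne j
      have h3 := Finset.add_le_sum (f := fun j => (ch j).size) (fun _ _ => Nat.zero_le _)
        (Finset.mem_univ i) (Finset.mem_univ j) hi
      have h4 := (ch i).size_pos
      omega
    have hexp : 1 + ∑ j, (2 * (ch j).size - 1) ≤ 2 * (BTree.node c n ch).size - 1 := by
      have h1 : ∑ j, (2 * (ch j).size - 1) + ∑ _j : Fin (n + 2), 1 = ∑ j, 2 * (ch j).size := by
        rw [← Finset.sum_add_distrib]
        refine Finset.sum_congr rfl fun j _ => ?_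
        have := (ch j).size_pos
        omega
      rw [← Finset.mul_sum] at h1
      simp only [Finset.sum_const, Finset.card_univ, Fintype.card_fin, smul_eq_mul, mul_one] at h1
      rw [BTree.size]
      omega
    calc (δ * litProb k) ^ (2 * (BTree.node c n ch).size - 1)
        ≤ (δ * litProb k) ^ (1 + ∑ j, (2 * (ch j).size - 1)) :=
          pow_le_pow_right_of_le_one' hθ hexp
      _ = δ * litProb k * ∏ j, (δ * litProb k) ^ (2 * (ch j).size - 1) := by
          rw [pow_add, pow_one, Finset.prod_pow_eq_pow_sum]
      _ ≤ p (n + 2) * 2⁻¹ * ∏ j, gwWeight p H (ch j) := by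
          gcongr with j
          · exact litProb_le_half
          · exact pow_le_gwWeight p hδ0 hδN H (ch j) (hch j) (hsize j)

/-! ### The lower bound -/

/-- A tree representing the same function as `τ` whatever replaces the leaf `(0, true)` at the end
of the path through the first children, which plays the role of the spine: the second node of this
path has the constant value `true`. -/
def BTree.frame (N : ℕ) (τ : BTree k) : BTree k :=
  fork N true (fork N false (fork N false (.leaf (0, true)) (.leaf (0, false)))
    (.leaf (0, true))) τ

omit [NeZero k] in
/-- Constraints giving the shape of `τ` to all children of `u` except the first. -/
def sibC (N H : ℕ) (τ : BTree k) (u : List ℕ) : List (List ℕ × Set ℕ) :=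
  (List.finRange (N + 2)).flatMap fun j => if j = 0 then [] else offC H τ (j.1 :: u)

omit [NeZero k] in
theorem below_ite_offC (N H : ℕ) (τ : BTree k) (u : List ℕ) (j : Fin (N + 2)) :
    Below (j.1 :: u) (if j = 0 then [] else offC H τ (j.1 :: u)) := by
  split_ifs
  · simp [Below]
  · exact below_offC _ _ _

omit [NeZero k] in
theorem nodupKeys_sibC (N H : ℕ) (τ : BTree k) (u : List ℕ) : NodupKeys (sibC N H τ u) := by
  refine NodupKeys.flatMap (below_ite_offC N H τ u) fun j => ?_
  split_ifs
  · simp [NodupKeys]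
  · exact nodupKeys_offC _ _ _

omit [NeZero k] in
theorem below_sibC (N H : ℕ) (τ : BTree k) (u : List ℕ) : Below u (sibC N H τ u) :=
  Below.flatMap (below_ite_offC N H τ u)

omit [NeZero k] in
theorem not_below_sibC {N H : ℕ} {τ : BTree k} {u : List ℕ} {c : List ℕ × Set ℕ}
    (hc : c ∈ sibC N H τ u) : ¬ (0 :: u) <:+ c.1 := by
  intro h
  obtain ⟨j, -, hj⟩ := List.mem_flatMap.1 hc
  have := suffix_cons_inj h (below_ite_offC N H τ u j c hj)
  have h0 : j = 0 := Fin.ext this.symm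
  rw [if_pos h0] at hj
  simp at hj

omit [NeZero k] in
theorem mass_sibC (p : PMF ℕ) (N H : ℕ) (τ : BTree k) (u : List ℕ) :
    mass p.toMeasure (sibC N H τ u) = gwShape p H τ ^ (N + 1) := by
  have h : ∀ j : Fin (N + 1), mass p.toMeasure (if j.succ = (0 : Fin (N + 2)) then []
      else offC H τ (j.succ.1 :: u)) = gwShape p H τ := by
    intro j
    rw [if_neg (Fin.succ_ne_zero j), mass_offC]
  rw [sibC, mass_flatMap, Fin.prod_univ_succ, Finset.prod_congr rfl fun j _ => h j]
  simp [mass]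

omit [NeZero k] in
/-- A node of the spine with its first child on the spine, whose other children have prescribed
shapes and labels. -/
theorem truncation_eq_node {N H : ℕ} {ω : (List ℕ → ℕ) × (ℕ → ℕ × ℕ)}
    {lab : List ℕ → Bool × (Fin k × Bool)} {u : List ℕ} {c : Bool} {σ τ : BTree k}
    (hs : spine ω.2 u.length = u) (hu : ω.2 u.length = (N + 2, 0)) (hτ : τ.size ≤ H)
    (ho : Satisfies ω.1 (sibC N H τ u)) (hl : Satisfies lab (labC (.fork N c σ τ) u)) :
    spine ω.2 (0 :: u).length = 0 :: u ∧ Satisfies lab (labC σ (0 :: u)) ∧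
    ∀ h, H ≤ h → truncation (offspring ω) lab (h + 1) u =
      .fork N c (truncation (offspring ω) lab h (0 :: u)) τ := by
  have hs' : spine ω.2 (u.length + 1) = 0 :: u := by rw [spine, hs, hu]
  rw [BTree.fork, labC, satisfies_cons, satisfies_flatMap] at hl
  refine ⟨hs', hl.2 0, fun h hh => ?_⟩
  have hn : offspring ω u = N + 2 := by rw [offspring, if_pos hs.symm, hu]
  have hc : (lab u).1 = c := hl.1
  rw [truncation_add_two lab h hn, hc, BTree.fork]
  congr
  funext j
  refine Fin.cases rfl (fun j => ?_) j
  rw [Fin.cons_succ]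
  refine truncation_eq_of_satisfies H τ _ hτ (fun d hd => ?_) (hl.2 j.succ) h hh
  rw [offspring_off_spine ω hs' (i := j.succ.1) (by simp) (below_offC _ _ _ d hd)]
  have := (satisfies_flatMap.1 ho) j.succ
  rw [if_neg (Fin.succ_ne_zero j)] at this
  exact this d hd

/-- The beginning of the spine can be such that the tree represents the function of `τ`. -/
theorem frame_le_fullMeasure (p : PMF ℕ) (hp : ∑' n : ℕ, (n : ℝ≥0∞) * p n = 1) (N : ℕ)
    (τ : BTree k) :
    p (N + 2) ^ 3 * (gwShape p τ.size τ ^ (N + 1) * p 0 ^ (N + 1) * p 0 ^ (N + 1)) *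
      labWeight (BTree.frame N τ) ≤
    fullMeasure k p hp {ω | Represents (offspring ω.1) ω.2 τ.eval} := by
  let C := sibC N τ.size τ [] ++ sibC N 1 (.leaf ((0 : Fin k), true)) [0] ++
    sibC N 1 (.leaf ((0 : Fin k), false)) [0, 0]
  let D : List (ℕ × Set (ℕ × ℕ)) :=
    [(0, {(N + 2, 0)}), (1, {(N + 2, 0)}), (2, {(N + 2, 0)})]
  have hC : NodupKeys C := by
    refine NodupKeys.append (NodupKeys.append (nodupKeys_sibC _ _ _ _) (nodupKeys_sibC _ _ _ _)
      ?_) (nodupKeys_sibC _ _ _ _) ?_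
    · exact fun c hc d hd hcd => not_below_sibC hc (hcd ▸ below_sibC _ _ _ _ d hd)
    · intro c hc d hd hcd
      have hd' := hcd ▸ below_sibC _ _ _ _ d hd
      rcases List.mem_append.1 hc with hc | hc
      · exact not_below_sibC hc ((List.suffix_cons 0 [0]).trans hd')
      · exact not_below_sibC hc hd'
  have hD : NodupKeys D := by simp [NodupKeys, D]
  have hmass : fullMeasure k p hp ({ω | Satisfies ω.1 C ∧ Satisfies ω.2 D} ×ˢ
      {lab | Satisfies lab (labC (BTree.frame N τ) [])}) =
      p (N + 2) ^ 3 * (gwShape p τ.size τ ^ (N + 1) * p 0 ^ (N + 1) * p 0 ^ (N + 1)) *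
        labWeight (BTree.frame N τ) := by
    rw [Measure.prod_prod, treeMeasure_satisfies p hp hC hD, labelMeasure,
      infinitePi_satisfies _ (nodupKeys_labC _ _), mass_labC, mass_append, mass_append, mass_sibC,
      mass_sibC, mass_sibC]
    simp only [D, mass_cons, sizeBiased_singleton p hp (Nat.succ_pos (N + 1)), gwShape]
    simp only [mass, List.map_nil, List.prod_nil]
    ring
  rw [← hmass]
  refine measure_mono ?_
  rintro ⟨ω, lab⟩ ⟨⟨h1, h2⟩, h3⟩
  simp only [C, satisfies_append] at h1
  simp only [D, satisfies_cons, Set.mem_singleton_iff] at h2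
  obtain ⟨hs1, hl1, ht0⟩ := truncation_eq_node (u := []) rfl h2.1 le_rfl h1.1.1 h3
  obtain ⟨hs2, hl2, ht1⟩ := truncation_eq_node (H := 1) (u := [0]) hs1 h2.2.1 (le_of_eq rfl) h1.1.2 hl1
  obtain ⟨-, -, ht2⟩ := truncation_eq_node (H := 1) (u := [0, 0]) hs2 h2.2.2.1 (le_of_eq rfl) h1.2 hl2
  refine Filter.eventually_atTop.2 ⟨τ.size + 4, fun h hh => ?_⟩
  obtain ⟨h, rfl⟩ : ∃ h', h = h' + 1 + 1 + 1 := ⟨h - 3, by omega⟩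
  change (truncation (offspring ω) lab (h + 1 + 1 + 1) []).eval = τ.eval
  rw [ht0 _ (by omega), ht1 _ (by omega), ht2 _ (by omega)]
  funext x
  refine eq_of_eq_iff (c := true) ?_
  rw [BTree.eval_fork, and_iff_right_iff_imp]
  intro _
  -- the disjunctions below the root contain both a variable and its negation
  by_contra h0
  rw [Bool.not_eq_true, BTree.eval_fork, BTree.eval_fork] at h0
  have hx1 := h0.2
  have hx2 := h0.1.2
  simp only [BTree.eval, if_true] at hx1
  simp [BTree.eval, hx1] at hx2

omit [NeZero k] in
theorem labWeight_fork (N : ℕ) (c : Bool) (σ τ : BTree k) :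
    labWeight (.fork N c σ τ) = 2⁻¹ * (labWeight σ * labWeight τ ^ (N + 1)) := by
  rw [BTree.fork, labWeight, Fin.prod_univ_succ]
  simp

theorem exists_apply_add_two_ne_zero (p : PMF ℕ) (hmean : ∑' n : ℕ, (n : ℝ≥0∞) * p n = 1)
    (hone : p 1 = 0) : ∃ N, p (N + 2) ≠ 0 := by
  by_contra! h
  have : ∑' n : ℕ, (n : ℝ≥0∞) * p n = 0 := by
    rw [tsum_nat_eq_add_add fun n : ℕ => (n : ℝ≥0∞) * p n, hone]
    simp [h]
  rw [this] at hmean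
  exact zero_ne_one hmean

theorem exists_le_prob (p : PMF ℕ) (hmean : ∑' n : ℕ, (n : ℝ≥0∞) * p n = 1) (hone : p 1 = 0) :
    ∃ c : ℝ, 0 < c ∧ ∀ (k : ℕ) [NeZero k], 2 ≤ k → ∀ f : BoolFun k, ¬ IsConst f →
      Real.exp (-c * complexity f * Real.log k) ≤ prob p hmean k f := by
  obtain ⟨N, hN⟩ := exists_apply_add_two_ne_zero p hmean hone
  set δ : ℝ≥0∞ := min (p 0) (p (N + 2)) with hδ
  have hp0 : p 0 ≠ 0 := fun h0 => by
    have := apply_zero_pos p hmean hone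
    simp [h0] at this
  have hδ0 : δ ≠ 0 := by
    rw [hδ, Ne, min_eq_iff]
    rintro (⟨h, -⟩ | ⟨h, -⟩)
    · exact hp0 h
    · exact hN h
  have hδ1 : δ ≤ 1 := (min_le_left _ _).trans (p.coe_le_one 0)
  have hδtop : δ ≠ ∞ := ne_top_of_le_ne_top ENNReal.one_ne_top hδ1
  set d := δ.toReal with hd
  have hd0 : 0 < d := ENNReal.toReal_pos hδ0 hδtop
  have hd1 : d ≤ 1 := ENNReal.toReal_le_of_le_ofReal zero_le_one (by simpa using hδ1)
  have hlogd : 0 ≤ -Real.log d := by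
    have := Real.log_nonpos hd0.le hd1
    linarith
  have hlog2 : 0 < Real.log 2 := Real.log_pos one_lt_two
  set M : ℕ := 4 + (N + 1) * (2 * (1 + N * (N + 2)) + 1) with hM
  refine ⟨M * (2 + -Real.log d / Real.log 2), by positivity, fun k _ hk f hf => ?_⟩
  obtain ⟨τ₀, rfl, hτ₀⟩ := exists_size_eq_complexity hf
  obtain ⟨τ, hτN, hτe, hτs⟩ := exists_isNary N τ₀
  rw [← hτ₀]
  set m := τ₀.size
  have hm : 1 ≤ m := τ₀.size_pos
  have hθ1 : δ * litProb k ≤ 1 := mul_le_one' hδ1 (litProb_le_half.trans (by simp))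
  have hgw := pow_le_gwWeight (k := k) p (min_le_left _ _) (min_le_right _ _) τ.size τ hτN le_rfl
  have hlow : (δ * litProb k) ^ (M * m) ≤
      fullMeasure k p hmean {ω | Represents (offspring ω.1) ω.2 τ₀.eval} := by
    rw [← hτe]
    refine le_trans ?_ (frame_le_fullMeasure p hmean N τ)
    have hexp : 3 + (2 * τ.size - 1) * (N + 1) + (N + 1) + (N + 1) + 1 ≤ M * m := by
      have h1 : 2 * τ.size - 1 + 1 + 1 ≤ (2 * (1 + N * (N + 2)) + 1) * m := by
        have := τ.size_pos
        have h2 : τ.size ≤ (1 + N * (N + 2)) * m := by omega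
        calc 2 * τ.size - 1 + 1 + 1 ≤ 2 * ((1 + N * (N + 2)) * m) + m := by omega
          _ = _ := by ring
      calc 3 + (2 * τ.size - 1) * (N + 1) + (N + 1) + (N + 1) + 1
          = 4 + (N + 1) * (2 * τ.size - 1 + 1 + 1) := by ring
        _ ≤ 4 * m + (N + 1) * ((2 * (1 + N * (N + 2)) + 1) * m) := by
            gcongr
            omega
        _ = M * m := by rw [hM]; ring
    refine (pow_le_pow_right_of_le_one' hθ1 hexp).trans ?_
    rw [BTree.frame, labWeight_fork, labWeight_fork, labWeight_fork]
    simp only [labWeight]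
    calc (δ * litProb k) ^ (3 + (2 * τ.size - 1) * (N + 1) + (N + 1) + (N + 1) + 1)
        = (δ * litProb k) ^ 3 * ((δ * litProb k) ^ (2 * τ.size - 1)) ^ (N + 1) *
            (δ * litProb k) ^ (N + 1) * (δ * litProb k) ^ (N + 1) * (δ * litProb k) := by
          rw [← pow_mul]; ring
      _ ≤ (p (N + 2) * 2⁻¹) ^ 3 * gwWeight p τ.size τ ^ (N + 1) *
            (p 0 * litProb k) ^ (N + 1) * (p 0 * litProb k) ^ (N + 1) * (1 * litProb k) := by
          gcongr
          · exact min_le_right _ _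
          · exact litProb_le_half
          · exact min_le_left _ _
          · exact min_le_left _ _
      _ = _ := by
          rw [← gwShape_mul_labWeight]
          ring
  have hk0 : (0 : ℝ) < k := by exact_mod_cast (by omega : 0 < k)
  have hlogk : Real.log 2 ≤ Real.log k :=
    Real.log_le_log two_pos (by exact_mod_cast hk)
  have hreal : (d * (1 / (2 * k))) ^ (M * m) ≤ prob p hmean k τ₀.eval := by
    have := ENNReal.toReal_mono (measure_ne_top _ _) hlow
    rw [ENNReal.toReal_pow, ENNReal.toReal_mul, litProb_eq,
      ENNReal.toReal_ofReal (by positivity)] at this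
    exact this
  refine le_trans ?_ hreal
  have hpos : 0 < d * (1 / (2 * k)) := by positivity
  rw [← Real.exp_log hpos, ← Real.exp_nat_mul, Real.exp_le_exp,
    Real.log_mul hd0.ne' (by positivity), one_div, Real.log_inv,
    Real.log_mul two_ne_zero hk0.ne']
  have h1 : -Real.log d ≤ -Real.log d / Real.log 2 * Real.log k := by
    rw [div_mul_eq_mul_div, le_div_iff₀ hlog2]
    gcongr
  have h2 : -((2 + -Real.log d / Real.log 2) * Real.log k) ≤
      Real.log d + -(Real.log 2 + Real.log k) := by
    nlinarith
  calc -(M * (2 + -Real.log d / Real.log 2)) * m * Real.log k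
      = (M * m : ℝ) * -((2 + -Real.log d / Real.log 2) * Real.log k) := by ring
    _ ≤ (M * m : ℝ) * (Real.log d + -(Real.log 2 + Real.log k)) := by gcongr
    _ = _ := by push_cast; ring

end Lower

/-! ### Read-once functions -/

/-- The value of a tree depends only on the variables that occur in it. -/
theorem BTree.eval_congr : ∀ (τ : BTree k) {x y : Fin k → Bool},
    (∀ v, τ.occ v ≠ 0 → x v = y v) → τ.eval x = τ.eval y
  | .leaf l, x, y, h => by
    have := h l.1 (by simp [BTree.occ])
    simp [BTree.eval, this]
  | .node c n ch, x, y, h => by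
    have ih : ∀ j, (ch j).eval x = (ch j).eval y := fun j =>
      (ch j).eval_congr fun v hv => h v fun h0 => hv (by
        rw [BTree.occ, Finset.sum_eq_zero_iff] at h0
        exact h0 j (Finset.mem_univ j))
    cases c <;> simp only [BTree.eval, ih]

theorem occ_ne_zero_of_isEssential {τ : BTree k} {i : Fin k} (h : IsEssential τ.eval i) :
    τ.occ i ≠ 0 := by
  rintro h0
  obtain ⟨x, hx⟩ := h
  refine hx (τ.eval_congr fun v hv => ?_)
  have : v ≠ i := fun hvi => hv (hvi ▸ h0)
  simp [this]

theorem BTree.sum_occ : ∀ τ : BTree k, ∑ i, τ.occ i = τ.size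
  | .leaf l => by simp [BTree.occ, BTree.size]
  | .node c n ch => by
    simp only [BTree.occ, BTree.size]
    rw [Finset.sum_comm]
    exact Finset.sum_congr rfl fun j _ => (ch j).sum_occ

theorem ess_eval_le_size (τ : BTree k) : ess τ.eval ≤ τ.size := by
  classical
  rw [ess, Set.ncard_eq_toFinset_card', ← τ.sum_occ, Finset.card_eq_sum_ones]
  calc ∑ i ∈ {i | IsEssential τ.eval i}.toFinset, 1
      ≤ ∑ i ∈ {i | IsEssential τ.eval i}.toFinset, τ.occ i :=
        Finset.sum_le_sum fun i hi =>
          Nat.one_le_iff_ne_zero.2 (occ_ne_zero_of_isEssential (by simpa using hi))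
    _ ≤ ∑ i, τ.occ i := Finset.sum_le_univ_sum_of_nonneg fun _ => Nat.zero_le _

theorem ess_le_complexity [NeZero k] {f : BoolFun k} (hf : ¬ IsConst f) :
    ess f ≤ complexity f := by
  obtain ⟨τ, rfl, hτ⟩ := exists_size_eq_complexity hf
  rw [← hτ]
  exact ess_eval_le_size τ

section ReadOnce

variable {c : Bool} {n : ℕ} {ch : Fin (n + 2) → BTree k}

theorem occ_child_le (j : Fin (n + 2)) (v : Fin k) :
    (ch j).occ v ≤ (BTree.node c n ch).occ v :=
  Finset.single_le_sum (f := fun j => (ch j).occ v) (fun _ _ => Nat.zero_le _) (Finset.mem_univ j)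

theorem occ_child_unique (h : ∀ v, (BTree.node c n ch).occ v ≤ 1) {v : Fin k} {i j : Fin (n + 2)}
    (hi : (ch i).occ v ≠ 0) (hj : (ch j).occ v ≠ 0) : i = j := by
  by_contra hij
  have h1 := Finset.add_le_sum (f := fun j => (ch j).occ v) (fun _ _ => Nat.zero_le _)
    (Finset.mem_univ i) (Finset.mem_univ j) hij
  have h2 := h v
  rw [BTree.occ] at h2
  omega

/-- As the children of a node of a read-once tree have no common variables, inputs for the
children can be combined. -/
theorem exists_combine (h : ∀ v, (BTree.node c n ch).occ v ≤ 1)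
    (y : Fin (n + 2) → Fin k → Bool) :
    ∃ x : Fin k → Bool, ∀ j v, (ch j).occ v ≠ 0 → x v = y j v := by
  classical
  refine ⟨fun v => if hv : ∃ j, (ch j).occ v ≠ 0 then y hv.choose v else true, fun j v hv => ?_⟩
  have hex : ∃ j, (ch j).occ v ≠ 0 := ⟨j, hv⟩
  beta_reduce
  rw [dif_pos hex, occ_child_unique h hex.choose_spec hv]

theorem exists_eval_eq_of_readOnce : ∀ (τ : BTree k), (∀ v, τ.occ v ≤ 1) → ∀ b : Bool,
    ∃ x, τ.eval x = b
  | .leaf l, _, b => ⟨fun _ => l.2 == b, by cases hl : l.2 <;> cases b <;> simp [BTree.eval, hl]⟩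
  | .node c n ch, h, b => by
    choose y hy using fun j => exists_eval_eq_of_readOnce (ch j)
      (fun v => (occ_child_le j v).trans (h v)) b
    obtain ⟨x, hx⟩ := exists_combine h y
    have hx' : ∀ j, (ch j).eval x = b := fun j => by
      rw [← hy j]; exact (ch j).eval_congr (hx j)
    refine ⟨x, ?_⟩
    cases c <;> cases b <;> simp [BTree.eval, hx']

/-- All variables of a read-once tree are essential: the siblings along the path to a variable
can be made irrelevant. -/
theorem isEssential_of_readOnce : ∀ (τ : BTree k), (∀ v, τ.occ v ≤ 1) → ∀ i, τ.occ i ≠ 0 →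
    IsEssential τ.eval i
  | .leaf l, _, i, hi => by
    have : l.1 = i := by
      by_contra h
      exact hi (by simp [BTree.occ, h])
    refine ⟨fun _ => true, ?_⟩
    cases hl : l.2 <;> simp [BTree.eval, hl, this]
  | .node c n ch, h, i, hi => by
    have hex : ∃ j, (ch j).occ i ≠ 0 := by
      by_contra! h0
      exact hi (Finset.sum_eq_zero fun j _ => h0 j)
    obtain ⟨j, hj⟩ := hex
    have hch := fun j v => (occ_child_le (c := c) (ch := ch) j v).trans (h v)
    obtain ⟨x, hx⟩ := isEssential_of_readOnce (ch j) (hch j) i hj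
    choose y hy using fun j => exists_eval_eq_of_readOnce (ch j) (hch j) c
    obtain ⟨w, hw⟩ := exists_combine h (Function.update y j x)
    have hself : ∀ b, (ch j).eval (Function.update w i b) =
        (ch j).eval (Function.update x i b) := by
      refine fun b => (ch j).eval_congr fun v hv => ?_
      have := hw j v hv
      rw [Function.update_self] at this
      by_cases hvi : v = i <;> simp [hvi, this]
    have hother : ∀ b j', j' ≠ j → (ch j').eval (Function.update w i b) = c := by
      intro b j' hj'
      rw [← hy j']
      refine (ch j').eval_congr fun v hv => ?_
      have hvi : v ≠ i := fun hvi => hj' (occ_child_unique h (hvi ▸ hv) hj)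
      have := hw j' v hv
      rw [Function.update_of_ne hj'] at this
      rw [Function.update_of_ne hvi, this]
    have hnode : ∀ b, (BTree.node c n ch).eval (Function.update w i b) = c ↔
        (ch j).eval (Function.update x i b) = c := by
      intro b
      rw [eval_node, ← hself b]
      refine ⟨fun h => h j, fun h j' => ?_⟩
      by_cases hj' : j' = j
      · rw [hj', h]
      · exact hother b j' hj'
    refine ⟨w, fun heq => hx ?_⟩
    have h0 := hnode false
    rw [heq, hnode true] at h0
    revert h0
    cases (ch j).eval (Function.update x i false) <;>
      cases (ch j).eval (Function.update x i true) <;> cases c <;> simp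

end ReadOnce

theorem ReadOnce.not_isConst {f : BoolFun k} (hf : ReadOnce f) : ¬ IsConst f := by
  obtain ⟨τ, rfl, hτ⟩ := hf
  rintro ⟨b, hb⟩
  obtain ⟨x, hx⟩ := exists_eval_eq_of_readOnce τ hτ !b
  rw [hb] at hx
  cases b <;> simp at hx

theorem ReadOnce.ess_eq_complexity [NeZero k] {f : BoolFun k} (hf : ReadOnce f) :
    ess f = complexity f := by
  classical
  refine le_antisymm (ess_le_complexity hf.not_isConst) ?_
  obtain ⟨τ, rfl, hτ⟩ := hf
  refine (complexity_le_size τ).trans ?_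
  rw [ess, Set.ncard_eq_toFinset_card', ← τ.sum_occ, Finset.card_eq_sum_ones, Set.toFinset_ofPred,
    Finset.sum_filter]
  refine Finset.sum_le_sum fun i _ => ?_
  by_cases hi : τ.occ i = 0
  · rw [hi]
    exact Nat.zero_le _
  · rw [if_pos (isEssential_of_readOnce τ hτ i hi)]
    exact hτ i

/-! ### Binomial coefficients -/

theorem div_pow_le_choose : ∀ (m n : ℕ), m ≤ n → ((n : ℝ) / m) ^ m ≤ n.choose m
  | 0, n, _ => by simp
  | m + 1, 0, h => by omega
  | m + 1, n + 1, h => by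
    have hmn : m ≤ n := by omega
    have ih := div_pow_le_choose m n hmn
    have h1 : ((n + 1).choose (m + 1) : ℝ) = (n + 1 : ℕ) / (m + 1 : ℕ) * n.choose m := by
      have := Nat.add_one_mul_choose_eq n m
      rw [div_mul_eq_mul_div, eq_div_iff (by positivity)]
      exact_mod_cast this.symm
    rw [h1, pow_succ']
    gcongr
    refine le_trans ?_ ih
    rcases Nat.eq_zero_or_pos m with rfl | hm
    · simp
    · gcongr 1
      have hm' : (0 : ℝ) < m := by exact_mod_cast hm
      have hmn' : (m : ℝ) ≤ n := by exact_mod_cast hmn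
      rw [div_le_div_iff₀ (by positivity) hm']
      push_cast
      nlinarith

/-- The binomial coefficient is large if the subsets are polynomially smaller than the set. -/
theorem mul_log_le_log_choose {m k : ℕ} (hm : 1 ≤ m) (hk : 1 ≤ k) {ε : ℝ} (hε : 0 < ε)
    (h : (m : ℝ) ≤ (k : ℝ) ^ (1 - ε)) : ε * m * Real.log k ≤ Real.log (k.choose m) := by
  have hk0 : (0 : ℝ) < k := by exact_mod_cast hk
  have hm0 : (0 : ℝ) < m := by exact_mod_cast hm
  have hk1 : (1 : ℝ) ≤ k := by exact_mod_cast hk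
  have hle : (k : ℝ) ^ ε ≤ k / m := by
    rw [le_div_iff₀ hm0]
    calc (k : ℝ) ^ ε * m ≤ (k : ℝ) ^ ε * (k : ℝ) ^ (1 - ε) := by gcongr
      _ = k := by rw [← Real.rpow_add hk0]; simp
  have hmk : m ≤ k := by
    have : (1 : ℝ) ≤ k / m := (Real.one_le_rpow hk1 hε.le).trans hle
    rw [one_le_div hm0] at this
    exact_mod_cast this
  calc ε * m * Real.log k = Real.log (((k : ℝ) ^ ε) ^ m) := by
        rw [Real.log_pow, Real.log_rpow hk0]; ring
    _ ≤ Real.log (k.choose m) := by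
        refine Real.log_le_log (by positivity) (le_trans ?_ (div_pow_le_choose m k hmk))
        gcongr

end AndOr

end

theorem mainTheorem7 (p : PMF ℕ) (hmean : ∑' n : ℕ, (n : ℝ≥0∞) * p n = 1) (hone : p 1 = 0)
    (hexp : ∃ a : ℝ, 0 < a ∧ ∑' n : ℕ, ENNReal.ofReal (Real.exp (a * n)) * p n < ∞) :
    ∃ c₁ c₂ : ℝ, 0 < c₁ ∧ 0 < c₂ ∧
      (∀ (k : ℕ) [NeZero k], 2 ≤ k → ∀ f : AndOr.BoolFun k,
        (¬ AndOr.IsConst f →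
          Real.exp (-c₁ * AndOr.complexity f * Real.log k) ≤ AndOr.prob p hmean k f) ∧
        AndOr.prob p hmean k f ≤
          Real.exp (-c₂ * AndOr.complexity f / (k : ℝ) ^ 2
            - Real.log (k.choose (AndOr.ess f)))) ∧
      (∀ ε : ℝ, 0 < ε → ∃ c₃ c₄ : ℝ, 0 < c₃ ∧ 0 < c₄ ∧
        ∀ (k : ℕ) [NeZero k], 2 ≤ k → ∀ f : AndOr.BoolFun k, AndOr.ReadOnce f →
          (AndOr.complexity f : ℝ) ≤ (k : ℝ) ^ (1 - ε) →
          AndOr.prob p hmean k f ≤ Real.exp (-c₃ * AndOr.complexity f * Real.log k) ∧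
          Real.exp (-c₂ * AndOr.complexity f / (k : ℝ) ^ 2
            - Real.log (k.choose (AndOr.ess f))) ^ c₄ ≤ AndOr.prob p hmean k f) := by
  obtain ⟨c₁, hc₁, hlower⟩ := AndOr.exists_le_prob p hmean hone
  obtain ⟨c₂, hc₂, hupper⟩ := AndOr.exists_prob_le p hmean hone hexp
  refine ⟨c₁, c₂, hc₁, hc₂, fun k _ hk f => ⟨hlower k hk f, hupper k f⟩, fun ε hε =>
    ⟨ε, c₁ / ε, hε, by positivity, fun k _ hk f hf hL => ?_⟩⟩
  have hess := hf.ess_eq_complexity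
  have hm : 1 ≤ AndOr.complexity f := by
    obtain ⟨τ, -, hτ⟩ := AndOr.exists_size_eq_complexity hf.not_isConst
    rw [← hτ]
    exact τ.size_pos
  have hchoose := AndOr.mul_log_le_log_choose hm (by omega) hε hL
  have hnonneg : 0 ≤ c₂ * AndOr.complexity f / (k : ℝ) ^ 2 := by positivity
  have hexponent : -c₂ * AndOr.complexity f / (k : ℝ) ^ 2 -
      Real.log (k.choose (AndOr.ess f)) ≤ -(ε * AndOr.complexity f * Real.log k) := by
    rw [hess, neg_mul, neg_div]
    linarith
  constructor
  · refine (hupper k f).trans (Real.exp_le_exp.2 (hexponent.trans (le_of_eq ?_)))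
    ring
  · refine le_trans ?_ (hlower k hk f hf.not_isConst)
    rw [← Real.exp_mul, Real.exp_le_exp]
    calc _ ≤ -(ε * AndOr.complexity f * Real.log k) * (c₁ / ε) := by gcongr
      _ = -c₁ * AndOr.complexity f * Real.log k := by field_simp
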